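/- Let $k,q\ge 1$ be integers, $p=k+q$, $S\in\mathbb R^{p\times p}$, $\alpha\in\mathbb R$, $\beta>0$, $0<c_1\le c_2$, and $K=S+\alpha(2I-\mathbf 1\mathbf 1^T)$. Index the coordinates of $w\in\mathbb R^{p(p-1)/2}$ by the pairs $i>j$ in $\{1,\dots,p\}$, and let $\mathcal L w\in\mathbb R^{p\times p}$ be the symmetric matrix with $[\mathcal L w]_{ij}=-w_{ij}$ for $i>j$ and $[\mathcal L w]_{ii}=-\sum_{j\neq i}[\mathcal L w]_{ij}$. Its adjoint is $[\mathcal L^*Y]_{ij}=Y_{ii}-Y_{ij}-Y_{ji}+Y_{jj}$ for $i>j$. Consider the problem $$\min_{w,U,\lambda}\; -\log\det\operatorname{Diag}(\lambda)+\operatorname{tr}(K\mathcal L w)+\tfrac{\beta}{2}\|\mathcal L w-U\operatorname{Diag}(\lambda)U^T\|_F^2 \qquad (\mathrm P)$$ over $w\in\mathbb R^{p(p-1)/2}$, $U\in\mathbb R^{p\times q}$, $\lambda\in\mathbb R^q$, subject to $w\ge 0$, $U^TU=I_q$ and $c_1\le\lambda_1\le\dots\le\lambda_q\le c_2$. A KKT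 point of (P) is a feasible point $(w,U,\lambda)$ for which there are multipliers $\mu_1\ge 0$ in $\mathbb R^{p(p-1)/2}$, $\mu_2\ge 0$ in $\mathbb R^{q+1}$ and $M\in\mathbb R^{q\times q}$ such that the gradient in $(w,U,\lambda)$ of the Lagrangian $$f(w,U,\lambda)-\mu_1^Tw+\mu_2^Th(\lambda)+\operatorname{tr}\big(M^T(U^TU-I_q)\big)$$ vanishes at $(w,U,\lambda)$ and complementary slackness holds for $\mu_1$ and $\mu_2$; here $f$ is the objective of (P) and $h(\lambda)=(c_1-\lambda_1,\lambda_1-\lambda_2,\dots,\lambda_{q-1}-\lambda_q,\lambda_q-c_2)$. Let $(w^t,U^t,\lambda^t)_{t\ge 0}$ be generated, from any starting point, by the SGL algorithm, whose step from $t$ to $t+1$ is as follows. 1. $w^{t+1}=\big(w^t-\tfrac1{2p}\nabla_t\big)^+$, where $\nabla_t=\mathcal L^*(\mathcal L w^t)-\mathcal L^*\big(U^t\operatorname{Diag}(\lambda^t)(U^t)^T-\beta^{-1}K\big)$ and $(\cdot)^+$ is the entrywise positive part. 2. The columns of $U^{t+1}$ are the members number $k+1,\dots,p$ of some orthonormal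 eigenbasis of $\mathcal L w^{t+1}$ listed in increasing order of the eigenvalues. 3. Let $d_i$ be the $i$-th diagonal entry of $(U^{t+1})^T(\mathcal L w^{t+1})U^{t+1}$ and put $\phi(s)=\big(s+\sqrt{s^2+4/\beta}\big)/2$. Start from $\lambda_i=\phi(d_i)$, $i=1,\dots,q$. As long as $c_1\le\lambda_1\le\dots\le\lambda_q\le c_2$ fails, choose a maximal nonincreasing run of consecutive entries to which one of the following rules applies (in any order) and apply the rule. (i) If $c_1\ge\lambda_1\ge\dots\ge\lambda_r$ with at least one inequality strict, set $\lambda_1=\dots=\lambda_r=c_1$. (ii) If $\lambda_s\ge\dots\ge\lambda_q\ge c_2$ with at least one inequality strict, set $\lambda_s=\dots=\lambda_q=c_2$. (iii) If $\lambda_i\ge\dots\ge\lambda_m$ with at least one inequality strict, and moreover $\lambda_1>c_1$ in case $i=1$ and $\lambda_q<c_2$ in case $m=q$, set $\lambda_i=\dots=\lambda_m=\phi\big(\tfrac1{m-i+1}\sum_{j=i}^m d_j\big)$. The vector returned is $\lambda^{t+1}$. Then $(w^t,U^t,\lambda^t)$ converges to the set of KKT points of (P): the set of KKT points is nonempty,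 the distance from $(w^t,U^t,\lambda^t)$ to it tends to $0$ as $t\to\infty$, and every limit point of the sequence is a KKT point of (P). -/

import Mathlib

open Filter Topology
open scoped Matrix

noncomputable section

namespace SGL

/-- Vertex pairs `(i, j)` with `i > j`: the `p (p - 1) / 2` coordinates of a weight vector. -/
abbrev Edge (p : ℕ) : Type := {e : Fin p × Fin p // e.2 < e.1}

theorem card_edge (p : ℕ) : Fintype.card (Edge p) = p * (p - 1) / 2 := by
  have h : Fintype.card (Edge p) = ∑ i : Fin p, (i : ℕ) := by
    have e : Edge p ≃ (Σ i : Fin p, {j : Fin p // j < i}) :=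
      { toFun := fun e => ⟨e.1.1, e.1.2, e.2⟩
        invFun := fun s => ⟨(s.1, s.2.1), s.2.2⟩
        left_inv := fun _ => rfl
        right_inv := fun _ => rfl }
    rw [Fintype.card_congr e, Fintype.card_sigma]
    refine Finset.sum_congr rfl fun i _ => ?_
    rw [Fintype.card_subtype, ← Fin.card_Iio i]
    congr 1
    ext j
    simp
  rw [h, Fin.sum_univ_eq_sum_range (fun i => i) p, Finset.sum_range_id]

/-- The variables `(w, U, lam)`, with `w` a vector indexed by vertex pairs, `U` a `p × q` array and
`lam` a vector of length `q`.  (All norms on this finite dimensional space are equivalent.) -/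
abbrev Point (p q : ℕ) : Type := (Edge p → ℝ) × (Fin p → Fin q → ℝ) × (Fin q → ℝ)

/-- The weight that `w` gives to the unordered pair `{i, j}` (zero if `i = j`). -/
def weight {p : ℕ} (w : Edge p → ℝ) (i j : Fin p) : ℝ :=
  if h : j < i then w ⟨(i, j), h⟩ else if h : i < j then w ⟨(j, i), h⟩ else 0

/-- The graph Laplacian operator. -/
def lap {p : ℕ} (w : Edge p → ℝ) : Matrix (Fin p) (Fin p) ℝ :=
  Matrix.of fun i j => if i = j then ∑ l, weight w i l else -weight w i j

/-- The adjoint of the graph Laplacian operator. -/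
def lapAdj {p : ℕ} (Y : Matrix (Fin p) (Fin p) ℝ) : Edge p → ℝ := fun e =>
  Y e.1.1 e.1.1 - Y e.1.1 e.1.2 - Y e.1.2 e.1.1 + Y e.1.2 e.1.2

/-- The squared Frobenius norm. -/
def frobSq {p : ℕ} (A : Matrix (Fin p) (Fin p) ℝ) : ℝ := ∑ i, ∑ j, A i j ^ 2

/-- `K = S + α (2 I - 1 1ᵀ)`: data matrix plus the sparsity penalty. -/
def dataMatrix {p : ℕ} (S : Matrix (Fin p) (Fin p) ℝ) (α : ℝ) : Matrix (Fin p) (Fin p) ℝ :=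
  S + α • ((2 : ℝ) • (1 : Matrix (Fin p) (Fin p) ℝ) - Matrix.of fun _ _ => 1)

/-- `U Diag(lam) Uᵀ`. -/
def spectralMatrix {p q : ℕ} (U : Fin p → Fin q → ℝ) (lam : Fin q → ℝ) :
    Matrix (Fin p) (Fin p) ℝ :=
  Matrix.of U * Matrix.diagonal lam * (Matrix.of U)ᵀ

/-! ### The relaxed problem and its KKT points -/

/-- The objective of the relaxed problem. -/
def objective {p q : ℕ} (S : Matrix (Fin p) (Fin p) ℝ) (α β : ℝ) (x : Point p q) : ℝ :=
  -Real.log (Matrix.diagonal x.2.2).det + (dataMatrix S α * lap x.1).trace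
    + β / 2 * frobSq (lap x.1 - spectralMatrix x.2.1 x.2.2)

/-- The set `c₁ ≤ lam_1 ≤ ⋯ ≤ lam_q ≤ c₂`. -/
def spectralSet (q : ℕ) (c₁ c₂ : ℝ) : Set (Fin q → ℝ) :=
  {lam | Monotone lam ∧ ∀ i, c₁ ≤ lam i ∧ lam i ≤ c₂}

/-- The inequality constraint functions of `spectralSet`, namely
`c₁ - lam_1, lam_1 - lam_2, …, lam_{q-1} - lam_q, lam_q - c₂`. -/
def chainConstraint {q : ℕ} (c₁ c₂ : ℝ) (lam : Fin q → ℝ) (i : Fin (q + 1)) : ℝ :=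
  (Fin.cons c₁ lam : Fin (q + 1) → ℝ) i - (Fin.snoc lam c₂ : Fin (q + 1) → ℝ) i

/-- The Lagrangian of the relaxed problem. -/
def lagrangian {p q : ℕ} (S : Matrix (Fin p) (Fin p) ℝ) (α β c₁ c₂ : ℝ)
    (μ₁ : Edge p → ℝ) (μ₂ : Fin (q + 1) → ℝ) (M : Matrix (Fin q) (Fin q) ℝ) (x : Point p q) : ℝ :=
  objective S α β x - ∑ e, μ₁ e * x.1 e + ∑ i, μ₂ i * chainConstraint c₁ c₂ x.2.2 i
    + (Mᵀ * ((Matrix.of x.2.1)ᵀ * Matrix.of x.2.1 - 1)).trace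

/-- KKT points of: minimize `objective` over `w ≥ 0`, `lam ∈ spectralSet`, `Uᵀ U = I`. -/
structure IsKKT {p q : ℕ} (S : Matrix (Fin p) (Fin p) ℝ) (α β c₁ c₂ : ℝ) (x : Point p q) :
    Prop where
  w_nonneg : ∀ e, 0 ≤ x.1 e
  lam_mem : x.2.2 ∈ spectralSet q c₁ c₂
  U_orth : (Matrix.of x.2.1)ᵀ * Matrix.of x.2.1 = 1
  exists_multipliers : ∃ (μ₁ : Edge p → ℝ) (μ₂ : Fin (q + 1) → ℝ) (M : Matrix (Fin q) (Fin q) ℝ),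
    (∀ e, 0 ≤ μ₁ e) ∧ (∀ i, 0 ≤ μ₂ i) ∧
    (∀ e, μ₁ e * x.1 e = 0) ∧ (∀ i, μ₂ i * chainConstraint c₁ c₂ x.2.2 i = 0) ∧
    HasFDerivAt (lagrangian S α β c₁ c₂ μ₁ μ₂ M) (0 : Point p q →L[ℝ] ℝ) x

def kktSet (p q : ℕ) (S : Matrix (Fin p) (Fin p) ℝ) (α β c₁ c₂ : ℝ) : Set (Point p q) :=
  {x | IsKKT S α β c₁ c₂ x}

/-! ### The update of `w` -/

/-- `∇f(w) = 𝓛*(𝓛 w) - c` with `c = 𝓛*(U Diag(lam) Uᵀ - β⁻¹ K)`. -/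
def gradW {p q : ℕ} (S : Matrix (Fin p) (Fin p) ℝ) (α β : ℝ) (x : Point p q) : Edge p → ℝ :=
  lapAdj (lap x.1) - lapAdj (spectralMatrix x.2.1 x.2.2 - β⁻¹ • dataMatrix S α)

/-- The projected gradient step `(w - ∇f(w) / (2p))⁺`. -/
def updateW {p q : ℕ} (S : Matrix (Fin p) (Fin p) ℝ) (α β : ℝ) (x : Point p q) : Edge p → ℝ :=
  fun e => max (x.1 e - 1 / (2 * (p : ℝ)) * gradW S α β x e) 0

/-! ### The update of `U` -/

/-- The columns of `U` are the members number `k + 1, …, k + q` of some orthonormal eigenbasis of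
`A` that is listed in increasing order of the eigenvalues. -/
def IsTopEigenvectors {k q : ℕ} (A : Matrix (Fin (k + q)) (Fin (k + q)) ℝ)
    (U : Fin (k + q) → Fin q → ℝ) : Prop :=
  ∃ (V : Matrix (Fin (k + q)) (Fin (k + q)) ℝ) (e : Fin (k + q) → ℝ),
    Vᵀ * V = 1 ∧ Monotone e ∧ A * V = V * Matrix.diagonal e ∧
      ∀ i j, U i j = V i (Fin.natAdd k j)

/-! ### The update of `lam` (regularized isotonic regression) -/

/-- The diagonal of `Uᵀ (𝓛 w) U`. -/
def spectralTarget {p q : ℕ} (w : Edge p → ℝ) (U : Fin p → Fin q → ℝ) : Fin q → ℝ :=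
  fun i => ((Matrix.of U)ᵀ * lap w * Matrix.of U) i i

def isoRoot (β d : ℝ) : ℝ := (d + √(d ^ 2 + 4 / β)) / 2

/-- The mean of `d_i, …, d_m`. -/
def blockMean {q : ℕ} (d : Fin q → ℝ) (i m : Fin q) : ℝ :=
  (∑ j ∈ Finset.Icc i m, d j) / ((Finset.Icc i m).card : ℝ)

/-- One update of the isotonic regression algorithm: one of its three situations is met on a
maximal nonincreasing run of `lam`, and the entries of that run are reset. -/
inductive IsoStep {q : ℕ} (β c₁ c₂ : ℝ) (d : Fin q → ℝ) : (Fin q → ℝ) → (Fin q → ℝ) → Prop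
  /-- `c₁ ≥ lam_1 ≥ ⋯ ≥ lam_r`, at least one inequality being strict (that is, `lam_r < c₁`). -/
  | lower (lam : Fin q → ℝ) (r : Fin q)
      (run : AntitoneOn lam (Set.Iic r)) (bound : ∀ j, j ≤ r → lam j ≤ c₁)
      (strict : lam r < c₁)
      (right_max : ∀ s : Fin q, (s : ℕ) = r + 1 → lam r < lam s) :
      IsoStep β c₁ c₂ d lam (fun j => if j ≤ r then c₁ else lam j)
  /-- `lam_s ≥ ⋯ ≥ lam_q ≥ c₂`, at least one inequality being strict (that is, `lam_s > c₂`). -/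
  | upper (lam : Fin q → ℝ) (s : Fin q)
      (run : AntitoneOn lam (Set.Ici s)) (bound : ∀ j, s ≤ j → c₂ ≤ lam j)
      (strict : c₂ < lam s)
      (left_max : ∀ r : Fin q, (s : ℕ) = r + 1 → lam r < lam s) :
      IsoStep β c₁ c₂ d lam (fun j => if s ≤ j then c₂ else lam j)
  /-- `lam_i ≥ ⋯ ≥ lam_m`, at least one inequality being strict (that is, `lam_m < lam_i`),
  outside the previous two situations. -/
  | pool (lam : Fin q → ℝ) (i m : Fin q) (le : i ≤ m)
      (run : AntitoneOn lam (Set.Icc i m)) (strict : lam m < lam i)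
      (left_max : ∀ r : Fin q, (i : ℕ) = r + 1 → lam r < lam i)
      (left_end : (i : ℕ) = 0 → c₁ < lam i)
      (right_max : ∀ s : Fin q, (s : ℕ) = m + 1 → lam m < lam s)
      (right_end : (m : ℕ) + 1 = q → lam m < c₂) :
      IsoStep β c₁ c₂ d lam
        (fun j => if i ≤ j ∧ j ≤ m then isoRoot β (blockMean d i m) else lam j)

/-- The isotonic regression algorithm with data `d` returns `lam`: start from `isoRoot β (d i)` and
update until the entries lie in `spectralSet`.  (There the updates no longer apply.) -/
def IsoReturns {q : ℕ} (β c₁ c₂ : ℝ) (d lam : Fin q → ℝ) : Prop :=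
  Relation.ReflTransGen (IsoStep β c₁ c₂ d) (fun i => isoRoot β (d i)) lam ∧
    lam ∈ spectralSet q c₁ c₂

/-! ### The algorithm -/

/-- `x 0, x 1, …` is a sequence of iterates of the algorithm, from an arbitrary starting point. -/
def IsSGLSequence {k q : ℕ} (S : Matrix (Fin (k + q)) (Fin (k + q)) ℝ) (α β c₁ c₂ : ℝ)
    (x : ℕ → Point (k + q) q) : Prop :=
  ∀ t, (x (t + 1)).1 = updateW S α β (x t) ∧
    IsTopEigenvectors (lap (x (t + 1)).1) (x (t + 1)).2.1 ∧
    IsoReturns β c₁ c₂ (spectralTarget (x (t + 1)).1 (x (t + 1)).2.1) (x (t + 1)).2.2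

end SGL

end

noncomputable section

namespace SGL

/-! ### The Laplacian operator, its adjoint and its norm -/

section Laplacian

variable {p : ℕ}

/-! The objective is a Lyapunov function. In `w` it is quadratic, and `‖𝓛‖² ≤ 2p` (`frobSq_lap_le`)
makes the projected step of length `1/(2p)` lower it by at least `βp‖Δw‖²` (`objective_updateW_le`).
In `U`, top eigenvectors maximize `∑ λ_j (Uᵀ 𝓛w U)_jj` for monotone nonnegative `λ`, by Birkhoff's
theorem and the rearrangement inequality. After that step the data `d` are eigenvalues in increasing
order, so pooling never happens: the isotonic routine returns the roots `φ(d_i)` clamped to `[c₁,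
c₂]` (`IsoReturns.eq_isoClamp`), which minimize the objective coordinate by coordinate.

From time 1 on the objective therefore decreases. It is coercive on the points that the algorithm
can reach, so the iterates stay in a compact set and `Δw → 0`. Limit points inherit the closed
conditions `IsSpectralPoint` and are fixed by the continuous map `updateW`. These two facts suffice
for the KKT conditions (`IsSpectralPoint.isKKT`): the limit columns need only be eigenvectors with
increasing eigenvalues, since KKT is a first-order notion. Compactness turns the statement on limit
points into convergence of the distance. -/

theorem weight_add (w v : Edge p → ℝ) (i j : Fin p) :
    weight (w + v) i j = weight w i j + weight v i j := by
  unfold weight; split_ifs <;> simp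

theorem weight_smul (c : ℝ) (w : Edge p → ℝ) (i j : Fin p) :
    weight (c • w) i j = c * weight w i j := by
  unfold weight; split_ifs <;> simp

theorem weight_comm (w : Edge p → ℝ) (i j : Fin p) : weight w i j = weight w j i := by
  unfold weight
  rcases lt_trichotomy i j with h | h | h
  · simp [h, h.not_gt]
  · subst h; simp
  · simp [h, h.not_gt]

theorem weight_self (w : Edge p → ℝ) (i : Fin p) : weight w i i = 0 := by
  simp [weight]

theorem weight_edge (w : Edge p → ℝ) (e : Edge p) : weight w e.1.1 e.1.2 = w e := by
  simp [weight, e.2]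

theorem lap_add (w v : Edge p → ℝ) : lap (w + v) = lap w + lap v := by
  ext i j
  simp only [lap, Matrix.of_apply, Matrix.add_apply, weight_add, Finset.sum_add_distrib]
  split_ifs <;> ring

theorem lap_smul (c : ℝ) (w : Edge p → ℝ) : lap (c • w) = c • lap w := by
  ext i j
  simp only [lap, Matrix.of_apply, Matrix.smul_apply, weight_smul, ← Finset.mul_sum, smul_eq_mul]
  split_ifs <;> ring

theorem lap_apply_edge (w : Edge p → ℝ) (e : Edge p) : lap w e.1.1 e.1.2 = -w e := by
  simp [lap, e.2.ne', weight_edge]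

theorem lap_transpose (w : Edge p → ℝ) : (lap w)ᵀ = lap w := by
  ext i j
  by_cases h : i = j
  · subst h; rfl
  · simp [lap, h, Ne.symm h, weight_comm w i j]

/-- `lap` as a linear map. -/
def lapLin (p : ℕ) : (Edge p → ℝ) →ₗ[ℝ] Matrix (Fin p) (Fin p) ℝ where
  toFun := lap
  map_add' := lap_add
  map_smul' := lap_smul

theorem continuous_lap : Continuous (lap : (Edge p → ℝ) → _) :=
  (lapLin p).continuous_of_finiteDimensional

/-- A double sum splits into its diagonal and the two orientations of every vertex pair. -/
theorem sum_sum_eq_diag_add_edge (f : Fin p → Fin p → ℝ) :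
    ∑ i, ∑ j, f i j = ∑ i, f i i + ∑ e : Edge p, (f e.1.1 e.1.2 + f e.1.2 e.1.1) := by
  have h1 : ∀ g : Fin p → Fin p → ℝ,
      ∑ e : Edge p, g e.1.1 e.1.2 = ∑ i, ∑ j, if j < i then g i j else 0 := by
    intro g
    rw [← Fintype.sum_prod_type' (fun i j => if j < i then g i j else 0), ← Finset.sum_filter]
    exact (Finset.sum_subtype (p := fun e : Fin p × Fin p => e.2 < e.1) _ (by simp)
      (fun e => g e.1 e.2)).symm
  rw [Finset.sum_add_distrib, h1 f, h1 (fun i j => f j i),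
    Finset.sum_comm (f := fun i j => if j < i then f j i else 0),
    ← Finset.sum_add_distrib, ← Finset.sum_add_distrib]
  refine Finset.sum_congr rfl fun i _ => ?_
  have : f i i = ∑ j, if j = i then f i j else 0 := by simp
  rw [this, ← Finset.sum_add_distrib, ← Finset.sum_add_distrib]
  refine Finset.sum_congr rfl fun j _ => ?_
  rcases lt_trichotomy i j with h | h | h
  · simp [h, h.not_gt, h.ne']
  · simp [h]
  · simp [h, h.not_gt, h.ne]

theorem sum_lap_mul (w : Edge p → ℝ) (Y : Matrix (Fin p) (Fin p) ℝ) :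
    ∑ i, ∑ j, lap w i j * Y i j = ∑ e, w e * lapAdj Y e := by
  have hd : ∑ i, lap w i i * Y i i = ∑ e : Edge p, w e * (Y e.1.1 e.1.1 + Y e.1.2 e.1.2) := by
    have : ∀ i, lap w i i * Y i i = ∑ l, weight w i l * Y i i := by
      intro i; simp [lap, Finset.sum_mul]
    simp only [this]
    rw [sum_sum_eq_diag_add_edge]
    simp only [weight_self, zero_mul, Finset.sum_const_zero, zero_add]
    refine Finset.sum_congr rfl fun e _ => ?_
    rw [weight_comm w e.1.2, weight_edge]; ring
  rw [sum_sum_eq_diag_add_edge, hd, ← Finset.sum_add_distrib]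
  refine Finset.sum_congr rfl fun e _ => ?_
  have h2 : lap w e.1.2 e.1.1 = -w e := by
    rw [← lap_apply_edge w e, ← Matrix.transpose_apply (lap w), lap_transpose]
  rw [lap_apply_edge, h2, lapAdj]; ring

/-- In a row, Cauchy–Schwarz bounds the squared diagonal entry by `p - 1` times the sum of the
squared weights, and the off-diagonal entries add that sum once more. Each edge lies in two rows.
This constant is what the step length `1/(2p)` is matched to. -/
theorem frobSq_lap_le (w : Edge p → ℝ) : frobSq (lap w) ≤ 2 * p * ∑ e, w e ^ 2 := by
  have hs : ∑ i, ∑ j, weight w i j ^ 2 = 2 * ∑ e, w e ^ 2 := by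
    rw [sum_sum_eq_diag_add_edge, Finset.mul_sum]
    simp only [weight_self, ne_eq, OfNat.ofNat_ne_zero, not_false_eq_true, zero_pow,
      Finset.sum_const_zero, zero_add]
    refine Finset.sum_congr rfl fun e _ => ?_
    rw [weight_comm w e.1.2, weight_edge]; ring
  have hrow : ∀ i, ∑ j, lap w i j ^ 2 ≤ p * ∑ j, weight w i j ^ 2 := by
    intro i
    have hsplit : ∀ g : Fin p → ℝ, ∑ j, g j = g i + ∑ j ∈ Finset.univ.erase i, g j := fun g =>
      (Finset.add_sum_erase _ g (Finset.mem_univ i)).symm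
    have hoff : ∑ j ∈ Finset.univ.erase i, lap w i j ^ 2
        = ∑ j ∈ Finset.univ.erase i, weight w i j ^ 2 :=
      Finset.sum_congr rfl fun j hj => by
        simp [lap, (Finset.ne_of_mem_erase hj).symm]
    have hdiag : lap w i i = ∑ j ∈ Finset.univ.erase i, weight w i j := by
      simp only [lap, Matrix.of_apply, if_true]
      rw [hsplit, weight_self, zero_add]
    have hcs := sq_sum_le_card_mul_sum_sq (s := Finset.univ.erase i) (f := fun j => weight w i j)
    have hp : 1 ≤ p := i.pos
    rw [Finset.card_erase_of_mem (Finset.mem_univ i), Finset.card_univ, Fintype.card_fin,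
      Nat.cast_sub hp, Nat.cast_one] at hcs
    rw [hsplit, hoff, hdiag, hsplit (fun j => weight w i j ^ 2), weight_self]
    linarith
  calc frobSq (lap w) ≤ ∑ i, p * ∑ j, weight w i j ^ 2 := Finset.sum_le_sum fun i _ => hrow i
    _ = 2 * p * ∑ e, w e ^ 2 := by rw [← Finset.mul_sum, hs]; ring

theorem lapAdj_sub (A B : Matrix (Fin p) (Fin p) ℝ) : lapAdj (A - B) = lapAdj A - lapAdj B := by
  ext e; simp [lapAdj]; ring

theorem lapAdj_smul (c : ℝ) (A : Matrix (Fin p) (Fin p) ℝ) : lapAdj (c • A) = c • lapAdj A := by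
  ext e; simp [lapAdj]; ring

theorem continuous_lapAdj : Continuous (lapAdj : Matrix (Fin p) (Fin p) ℝ → _) := by
  unfold lapAdj; fun_prop

theorem trace_mul_lap (K : Matrix (Fin p) (Fin p) ℝ) (w : Edge p → ℝ) :
    (K * lap w).trace = ∑ e, w e * lapAdj K e := by
  have h : lapAdj K = lapAdj Kᵀ := by ext e; simp [lapAdj]; ring
  rw [h, ← sum_lap_mul, Matrix.trace_mul_comm]
  simp [Matrix.trace, Matrix.mul_apply]

end Laplacian

/-! ### The step in `w` -/

/-- Variational inequality of the projection onto `[0, ∞)`: an equality when the positive part is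
inactive; otherwise the slack is `2p·w(s - w)` with `s = g/(2p) ≥ w ≥ 0`. -/
theorem projectedStep_le {p w g : ℝ} (hp : 0 < p) (hw : 0 ≤ w) :
    g * (max (w - 1 / (2 * p) * g) 0 - w) ≤ -(2 * p) * (max (w - 1 / (2 * p) * g) 0 - w) ^ 2 := by
  have hg : g = 2 * p * (1 / (2 * p) * g) := by field_simp
  set s := 1 / (2 * p) * g
  rw [hg]
  rcases le_total (w - s) 0 with h | h
  · rw [max_eq_right h]; nlinarith [mul_nonneg (mul_nonneg hp.le hw) (by linarith : 0 ≤ s - w)]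
  · rw [max_eq_left h]; nlinarith

theorem eq_projectedStep {p w g : ℝ} (hp : 0 < p) (h : max (w - 1 / (2 * p) * g) 0 = w) :
    0 ≤ g ∧ g * w = 0 := by
  have hg : g = 2 * p * (1 / (2 * p) * g) := by field_simp
  set s := 1 / (2 * p) * g
  rcases le_total (w - s) 0 with h' | h'
  · rw [max_eq_right h'] at h
    subst h
    have : 0 ≤ s := by linarith
    exact ⟨by rw [hg]; positivity, by simp⟩
  · rw [max_eq_left h'] at h
    have : s = 0 := by linarith
    rw [this] at hg
    simp [hg]

/-- The expansion in the increment `δ` is exact, with linear part `β⟨g, δ⟩ ≤ -2βp‖δ‖²` and quadratic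
part `(β/2)‖𝓛δ‖² ≤ βp‖δ‖²`. -/
theorem objective_updateW_le {p q : ℕ} (hp : 0 < p) (S : Matrix (Fin p) (Fin p) ℝ) {α β : ℝ}
    (hβ : 0 < β) (x : Point p q) (hw : ∀ e, 0 ≤ x.1 e) :
    objective S α β (updateW S α β x, x.2) + β * p * ∑ e, (updateW S α β x e - x.1 e) ^ 2
      ≤ objective S α β x := by
  obtain ⟨w, U, lam⟩ := x
  set δ : Edge p → ℝ := updateW S α β (w, U, lam) - w with hδ
  have hup : updateW S α β (w, U, lam) = w + δ := by simp [hδ]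
  set g := gradW S α β (w, U, lam) with hg
  set M := spectralMatrix U lam with hM
  have hgrad : ∑ e, g e * δ e ≤ -(2 * p) * ∑ e, δ e ^ 2 := by
    rw [Finset.mul_sum]
    exact Finset.sum_le_sum fun e _ => projectedStep_le (by exact_mod_cast hp) (hw e)
  have hfrob : frobSq (lap (w + δ) - M)
      = frobSq (lap w - M) + 2 * ∑ e, δ e * lapAdj (lap w - M) e + frobSq (lap δ) := by
    rw [← sum_lap_mul, lap_add]
    simp only [frobSq, Finset.mul_sum, ← Finset.sum_add_distrib, Matrix.sub_apply, Matrix.add_apply]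
    exact Finset.sum_congr rfl fun i _ => Finset.sum_congr rfl fun j _ => by ring
  have hlin : ∑ e, δ e * lapAdj (lap w - M) e + β⁻¹ * ∑ e, δ e * lapAdj (dataMatrix S α) e
      = ∑ e, g e * δ e := by
    rw [Finset.mul_sum, ← Finset.sum_add_distrib]
    refine Finset.sum_congr rfl fun e _ => ?_
    simp only [hg, gradW, lapAdj_sub, lapAdj_smul, Pi.sub_apply, Pi.smul_apply, smul_eq_mul]
    ring
  have hle := frobSq_lap_le δ
  have htr : (dataMatrix S α * lap (w + δ)).trace
      = (dataMatrix S α * lap w).trace + ∑ e, δ e * lapAdj (dataMatrix S α) e := by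
    rw [lap_add, Matrix.mul_add, Matrix.trace_add, trace_mul_lap _ δ]
  have e1 : ∑ e, (updateW S α β (w, U, lam) e - w e) ^ 2 = ∑ e, δ e ^ 2 := rfl
  simp only [e1, objective]
  rw [hup, hfrob, htr]
  have hT : ∑ e, δ e * lapAdj (dataMatrix S α) e
      = β * (β⁻¹ * ∑ e, δ e * lapAdj (dataMatrix S α) e) := by field_simp
  rw [hT]
  nlinarith [mul_le_mul_of_nonneg_left hle hβ.le, mul_le_mul_of_nonneg_left hgrad hβ.le]

/-! ### The step in `lam` -/

section Isotonic

variable {β c₁ c₂ : ℝ}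

theorem isoRoot_pos (hβ : 0 < β) (d : ℝ) : 0 < isoRoot β d := by
  have h : |d| < √(d ^ 2 + 4 / β) := by
    rw [← Real.sqrt_sq_eq_abs]
    exact Real.sqrt_lt_sqrt (sq_nonneg d) (by linarith [div_pos four_pos hβ])
  have := neg_abs_le d
  unfold isoRoot; linarith

/-- Stationarity of `-log λ + (β/2)(λ² - 2λd)`: `isoRoot β d` is the positive root of `βλ² - βdλ -
1`. -/
theorem isoRoot_eq (hβ : 0 < β) (d : ℝ) :
    β * isoRoot β d - 1 / isoRoot β d = β * d := by
  have hpos := isoRoot_pos hβ d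
  have hs : √(d ^ 2 + 4 / β) ^ 2 = d ^ 2 + 4 / β := Real.sq_sqrt (by positivity)
  have h : β * (isoRoot β d ^ 2 - d * isoRoot β d) = 1 := by
    unfold isoRoot
    have : β * (4 / β) = 4 := by field_simp
    linear_combination β / 4 * hs + this / 4
  field_simp
  linarith

theorem mul_sub_inv_le (hβ : 0 < β) {a b : ℝ} (ha : 0 < a) (hab : a ≤ b) :
    β * a - 1 / a ≤ β * b - 1 / b := by
  have := one_div_le_one_div_of_le ha hab
  nlinarith

theorem isoRoot_mono (hβ : 0 < β) : Monotone (isoRoot β) := by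
  intro d d' h
  by_contra! hlt
  have h1 := one_div_le_one_div_of_le (isoRoot_pos hβ d') hlt.le
  nlinarith [isoRoot_eq hβ d, isoRoot_eq hβ d', mul_le_mul_of_nonneg_left h hβ.le,
    mul_lt_mul_of_pos_left hlt hβ]

theorem continuous_isoRoot : Continuous (isoRoot β) := by
  unfold isoRoot; fun_prop

/-- The point of `[c₁, c₂]` nearest to `isoRoot β d`. -/
def isoClamp (β c₁ c₂ d : ℝ) : ℝ := max c₁ (min c₂ (isoRoot β d))

theorem continuous_isoClamp : Continuous (isoClamp β c₁ c₂) := by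
  have := continuous_isoRoot (β := β)
  unfold isoClamp; fun_prop

theorem le_isoClamp (d : ℝ) : c₁ ≤ isoClamp β c₁ c₂ d := le_max_left _ _

theorem isoClamp_le (hc : c₁ ≤ c₂) (d : ℝ) : isoClamp β c₁ c₂ d ≤ c₂ :=
  max_le hc (min_le_left _ _)

theorem isoClamp_mono (hβ : 0 < β) : Monotone (isoClamp β c₁ c₂) := fun _ _ h =>
  max_le_max le_rfl (min_le_min le_rfl (isoRoot_mono hβ h))

/-- With `isoClamp_eq_right_or`, the first-order optimality conditions on `[c₁, c₂]`. They give both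
the minimality of the clamp and, later, the multipliers of the chain constraints. -/
theorem isoClamp_eq_left_or (hβ : 0 < β) (hc₁ : 0 < c₁) (d : ℝ) :
    isoClamp β c₁ c₂ d = c₁ ∨ β * (isoClamp β c₁ c₂ d - d) - 1 / isoClamp β c₁ c₂ d ≤ 0 := by
  rw [or_iff_not_imp_left]
  intro h
  have hle : isoClamp β c₁ c₂ d ≤ isoRoot β d := by
    rcases max_choice c₁ (min c₂ (isoRoot β d)) with h' | h'
    · exact absurd h' h
    · exact h'.trans_le (min_le_right _ _)
  have := mul_sub_inv_le hβ (hc₁.trans_le (le_isoClamp d)) hle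
  rw [isoRoot_eq hβ] at this
  linarith

theorem isoClamp_eq_right_or (hβ : 0 < β) (hc : c₁ ≤ c₂) (d : ℝ) :
    isoClamp β c₁ c₂ d = c₂ ∨ 0 ≤ β * (isoClamp β c₁ c₂ d - d) - 1 / isoClamp β c₁ c₂ d := by
  rcases le_total c₂ (isoRoot β d) with h | h
  · left; simp [isoClamp, h, hc]
  · right
    have hle : isoRoot β d ≤ isoClamp β c₁ c₂ d := by simp [isoClamp, h]
    have := mul_sub_inv_le hβ (isoRoot_pos hβ d) hle
    rw [isoRoot_eq hβ] at this
    linarith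

/-- Convexity: the tangent bound for `log` and the leftover square `(β/2)(l - m)²` reduce the claim
to derivative times `(l - m)` being nonnegative. -/
theorem isoClamp_isMinOn (hβ : 0 < β) (hc₁ : 0 < c₁) (hc : c₁ ≤ c₂) (d : ℝ) {l : ℝ}
    (hl : c₁ ≤ l) (hl' : l ≤ c₂) :
    -Real.log (isoClamp β c₁ c₂ d) + β / 2 * (isoClamp β c₁ c₂ d ^ 2 - 2 * isoClamp β c₁ c₂ d * d)
      ≤ -Real.log l + β / 2 * (l ^ 2 - 2 * l * d) := by
  have h1 := isoClamp_eq_left_or (c₂ := c₂) hβ hc₁ d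
  have h2 := isoClamp_eq_right_or hβ hc d
  have hm1 := le_isoClamp (β := β) (c₁ := c₁) (c₂ := c₂) d
  have hm2 := isoClamp_le (β := β) hc d
  set m := isoClamp β c₁ c₂ d
  have hm : 0 < m := hc₁.trans_le hm1
  have hl0 : 0 < l := hc₁.trans_le hl
  have hlog : Real.log l - Real.log m ≤ 1 / m * (l - m) := by
    rw [← Real.log_div hl0.ne' hm.ne']
    have := Real.log_le_sub_one_of_pos (div_pos hl0 hm)
    refine this.trans (le_of_eq ?_)
    field_simp
  have hg : 0 ≤ (β * (m - d) - 1 / m) * (l - m) := by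
    rcases le_total 0 (β * (m - d) - 1 / m) with h | h
    · rcases h1 with h1 | h1
      · exact mul_nonneg h (by linarith)
      · rw [le_antisymm h1 h, zero_mul]
    · rcases h2 with h2 | h2
      · exact mul_nonneg_of_nonpos_of_nonpos h (by linarith)
      · rw [le_antisymm h h2, zero_mul]
  nlinarith [mul_nonneg hβ.le (sq_nonneg (l - m))]

variable {q : ℕ} {d lam lam' : Fin q → ℝ}

/-- For monotone data, the updates only ever reset an initial segment to `c₁` and a final segment
to `c₂`. -/
structure IsoInvariant (β c₁ c₂ : ℝ) (d lam : Fin q → ℝ) (a b : ℕ) : Prop where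
  lower : ∀ j : Fin q, (j : ℕ) < a → lam j = c₁ ∧ isoRoot β (d j) ≤ c₁
  upper : ∀ j : Fin q, a ≤ (j : ℕ) → b ≤ (j : ℕ) → lam j = c₂ ∧ c₂ ≤ isoRoot β (d j)
  middle : ∀ j : Fin q, a ≤ (j : ℕ) → (j : ℕ) < b → lam j = isoRoot β (d j)

/-- Entries not yet reset are `isoRoot β (d j)`, hence increasing. Resetting to a bound only
enlarges an end block, and a pool, which needs a strict descent, is impossible. -/
theorem IsoInvariant.step (hβ : 0 < β) (hc : c₁ ≤ c₂) (hd : Monotone d)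
    (h : IsoStep β c₁ c₂ d lam lam') {a b : ℕ} (hI : IsoInvariant β c₁ c₂ d lam a b) :
    ∃ a' b', IsoInvariant β c₁ c₂ d lam' a' b' := by
  have hmono : ∀ i j : Fin q, i ≤ j → isoRoot β (d i) ≤ isoRoot β (d j) := fun i j hij =>
    isoRoot_mono hβ (hd hij)
  cases h with
  | lower r run bound strict right_max =>
    have har : a ≤ (r : ℕ) := by
      by_contra! hlt
      linarith [(hI.lower r hlt).1]
    have hrb : (r : ℕ) < b := by
      by_contra! hle
      linarith [(hI.upper r har hle).1]
    have hr := hI.middle r har hrb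
    refine ⟨r + 1, b, ?_, ?_, ?_⟩
    · intro j hj
      have hjr : j ≤ r := Fin.le_def.2 (by omega)
      exact ⟨by simp [hjr], by linarith [hmono j r hjr]⟩
    · intro j hj hbj
      have hjr : ¬ j ≤ r := by rw [Fin.le_def]; omega
      simpa [hjr] using hI.upper j (by omega) hbj
    · intro j hj hbj
      have hjr : ¬ j ≤ r := by rw [Fin.le_def]; omega
      simpa [hjr] using hI.middle j (by omega) hbj
  | upper s run bound strict left_max =>
    have has : a ≤ (s : ℕ) := by
      by_contra! hlt
      linarith [(hI.lower s hlt).1]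
    have hsb : (s : ℕ) < b := by
      by_contra! hle
      linarith [(hI.upper s has hle).1]
    have hs := hI.middle s has hsb
    refine ⟨a, s, ?_, ?_, ?_⟩
    · intro j hj
      have hjs : ¬ s ≤ j := by rw [Fin.le_def]; omega
      simpa [hjs] using hI.lower j hj
    · intro j _ hj
      have hsj : s ≤ j := Fin.le_def.2 hj
      exact ⟨by simp [hsj], by linarith [hmono s j hsj]⟩
    · intro j haj hj
      have hjs : ¬ s ≤ j := by rw [Fin.le_def]; omega
      simpa [hjs] using hI.middle j haj (by omega)
  | pool i m hle run strict left_max left_end right_max right_end =>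
    exfalso
    have him : (i : ℕ) ≤ m := hle
    -- A pool cannot start inside the block at `c₁`: the first index is excluded by `left_end`, and
    -- any other has a predecessor with the same value, against maximality of the run. The right end
    -- is symmetric.
    have hai : a ≤ (i : ℕ) := by
      by_contra! hlt
      have hi := (hI.lower i hlt).1
      rcases Nat.eq_zero_or_pos (i : ℕ) with h0 | h0
      · linarith [left_end h0]
      · have hi' := i.isLt
        have := left_max ⟨i - 1, by omega⟩ (by simp; omega)
        rw [hi, (hI.lower _ (by simp; omega)).1] at this
        exact lt_irrefl _ this
    have hmb : (m : ℕ) < b := by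
      by_contra! hle
      have hm := (hI.upper m (by omega) hle).1
      have hm' := m.isLt
      rcases Nat.lt_or_ge (m + 1 : ℕ) q with h0 | h0
      · have := right_max ⟨m + 1, h0⟩ rfl
        rw [hm, (hI.upper _ (by simp; omega) (by simp; omega)).1] at this
        exact lt_irrefl _ this
      · linarith [right_end (by omega)]
    rw [hI.middle i hai (by omega), hI.middle m (by omega) hmb] at strict
    exact strict.not_ge (hmono i m hle)

/-- Membership of the output in `spectralSet` puts the untouched roots inside `[c₁, c₂]`, where
clamping is the identity; the invariant settles the two end blocks. The order in which rules were
applied thus does not matter. -/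
theorem IsoReturns.eq_isoClamp (hβ : 0 < β) (hc : c₁ ≤ c₂) (hd : Monotone d)
    (h : IsoReturns β c₁ c₂ d lam) : lam = fun i => isoClamp β c₁ c₂ (d i) := by
  obtain ⟨hsteps, -, hmem⟩ := h
  have hI : ∃ a b, IsoInvariant β c₁ c₂ d lam a b := by
    clear hmem
    induction hsteps with
    | refl =>
      exact ⟨0, q, fun j hj => absurd hj (Nat.not_lt_zero _),
        fun j _ hj => absurd j.isLt hj.not_gt, fun _ _ _ => rfl⟩
    | tail _ hstep ih =>
      obtain ⟨a, b, hI⟩ := ih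
      exact hI.step hβ hc hd hstep
  obtain ⟨a, b, hI⟩ := hI
  funext j
  obtain ⟨h1, h2⟩ := hmem j
  unfold isoClamp
  rcases Nat.lt_or_ge (j : ℕ) a with ha | ha
  · obtain ⟨e, hle⟩ := hI.lower j ha
    rw [e, min_eq_right (hle.trans hc), max_eq_left hle]
  · rcases Nat.lt_or_ge (j : ℕ) b with hb | hb
    · rw [hI.middle j ha hb] at h1 h2 ⊢
      rw [min_eq_right h2, max_eq_right h1]
    · obtain ⟨e, hle⟩ := hI.upper j ha hb
      rw [e, min_eq_left hle, max_eq_right hc]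

end Isotonic

/-! ### The step in `U` -/

section Eigenvectors

/-- The left side is linear in `P`, so by Birkhoff's theorem permutation matrices suffice, and for
these it is the rearrangement inequality. -/
theorem sum_doublyStochastic_le {n : Type*} [Fintype n] [DecidableEq n] {P : Matrix n n ℝ}
    (hP : P ∈ doublyStochastic ℝ n) {f g : n → ℝ} (hfg : Monovary f g) :
    ∑ i, ∑ j, P i j * (f i * g j) ≤ ∑ i, f i * g i := by
  let φ : Matrix n n ℝ →ₗ[ℝ] ℝ :=
    { toFun := fun P => ∑ i, ∑ j, P i j * (f i * g j)
      map_add' := fun A B => by simp [add_mul, Finset.sum_add_distrib]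
      map_smul' := fun c A => by simp [Finset.mul_sum, mul_assoc] }
  rw [← SetLike.mem_coe, doublyStochastic_eq_convexHull_permMatrix] at hP
  have hconv : Convex ℝ {A : Matrix n n ℝ | φ A ≤ ∑ i, f i * g i} :=
    convex_halfSpace_le φ.isLinear _
  refine convexHull_min ?_ hconv hP
  rintro _ ⟨σ, rfl⟩
  have : φ (σ.permMatrix ℝ) = ∑ i, f i * g (σ i) := by
    simp [φ, Equiv.Perm.permMatrix, PEquiv.toMatrix_apply]
  change φ (σ.permMatrix ℝ) ≤ _
  rw [this]
  exact hfg.sum_mul_comp_perm_le_sum_mul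

/-- `N = W Wᵀ` is an orthogonal projection, so `N_ii = ∑ N_il² ≥ N_ii²`. -/
theorem sum_sq_row_le_one {m n : Type*} [Fintype m] [Fintype n] [DecidableEq n]
    {W : Matrix m n ℝ} (hW : Wᵀ * W = 1) (i : m) : ∑ j, W i j ^ 2 ≤ 1 := by
  set N := W * Wᵀ with hN
  have hNN : N * N = N := by
    rw [hN, Matrix.mul_assoc, ← Matrix.mul_assoc Wᵀ, hW, Matrix.one_mul]
  have hsym : ∀ l, N l i = N i l := fun l => by
    simp [hN, Matrix.mul_apply, mul_comm]
  have hii : N i i = ∑ j, W i j ^ 2 := by simp [hN, Matrix.mul_apply, sq]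
  have h1 : N i i = ∑ l, N i l ^ 2 := by
    conv_lhs => rw [← hNN, Matrix.mul_apply]
    exact Finset.sum_congr rfl fun l _ => by rw [hsym, sq]
  have h2 : N i i ^ 2 ≤ N i i := by
    conv_rhs => rw [h1]
    exact Finset.single_le_sum (f := fun l => N i l ^ 2) (fun _ _ => sq_nonneg _)
      (Finset.mem_univ i)
  rw [← hii]
  nlinarith

variable {k q : ℕ} {A : Matrix (Fin (k + q)) (Fin (k + q)) ℝ} {U U' : Fin (k + q) → Fin q → ℝ}

/-- The top eigenvectors maximize `∑ j, lam j * (Uᵀ A U) j j` among all orthonormal systems. -/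
theorem IsTopEigenvectors.exists_eigenvalues (hk : 1 ≤ k) (h : IsTopEigenvectors A U) :
    ∃ e : Fin q → ℝ, Monotone e ∧ (Matrix.of U)ᵀ * Matrix.of U = 1 ∧
      A * Matrix.of U = Matrix.of U * Matrix.diagonal e ∧
      ∀ (U' : Fin (k + q) → Fin q → ℝ), (Matrix.of U')ᵀ * Matrix.of U' = 1 →
        ∀ lam : Fin q → ℝ, Monotone lam → (∀ i, 0 ≤ lam i) →
          ∑ j, lam j * ((Matrix.of U')ᵀ * A * Matrix.of U') j j ≤ ∑ j, lam j * e j := by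
  obtain ⟨V, e, hV, he, hAV, hU⟩ := h
  have hUV : Matrix.of U = V.submatrix id (Fin.natAdd k) := by
    ext i j; exact hU i j
  refine ⟨fun j => e (Fin.natAdd k j), fun i j hij => he (by simpa using hij), ?_, ?_, ?_⟩
  · rw [hUV]
    ext i j
    have := congrFun (congrFun hV (Fin.natAdd k i)) (Fin.natAdd k j)
    simpa [Matrix.mul_apply, Matrix.one_apply] using this
  · rw [hUV]
    ext i j
    have := congrFun (congrFun hAV i) (Fin.natAdd k j)
    rw [Matrix.mul_diagonal] at this ⊢
    simpa [Matrix.mul_apply] using this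
  · intro U' hU' lam hlam hlam0
    have hVV : V * Vᵀ = 1 := mul_eq_one_comm.1 hV
    have hA : A = V * Matrix.diagonal e * Vᵀ := by
      rw [← hAV, Matrix.mul_assoc, hVV, Matrix.mul_one]
    set W := Vᵀ * Matrix.of U' with hWdef
    have hW : Wᵀ * W = 1 := by
      rw [hWdef, Matrix.transpose_mul, Matrix.transpose_transpose, Matrix.mul_assoc,
        ← Matrix.mul_assoc V, hVV, Matrix.one_mul, hU']
    have hWA : (Matrix.of U')ᵀ * A * Matrix.of U' = Wᵀ * Matrix.diagonal e * W := by
      rw [hA, hWdef, Matrix.transpose_mul, Matrix.transpose_transpose]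
      simp only [Matrix.mul_assoc]
    have hWjj : ∀ j, ((Matrix.of U')ᵀ * A * Matrix.of U') j j = ∑ i, W i j ^ 2 * e i := by
      intro j
      rw [hWA, Matrix.mul_apply]
      refine Finset.sum_congr rfl fun i _ => ?_
      rw [Matrix.mul_diagonal, Matrix.transpose_apply]; ring
    have hcol : ∀ j, ∑ i, W i j ^ 2 = 1 := by
      intro j
      have := congrFun (congrFun hW j) j
      simpa [Matrix.mul_apply, sq] using this
    have hk0 : (0 : ℝ) < k := by exact_mod_cast hk
    -- The squared entries of `W` fill `q` columns; the deficit of each row is spread evenly over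
    -- the other `k`, whose sums are `((k + q) - q)/k = 1`. This needs `k ≥ 1`.
    let P : Matrix (Fin (k + q)) (Fin (k + q)) ℝ := Matrix.of fun i l =>
      Fin.addCases (fun _ => (1 - ∑ j, W i j ^ 2) / k) (fun j => W i j ^ 2) l
    have hP1 : ∀ i l, P i (Fin.castAdd q l) = (1 - ∑ j, W i j ^ 2) / k := by simp [P]
    have hP2 : ∀ i j, P i (Fin.natAdd k j) = W i j ^ 2 := by simp [P]
    have hP : P ∈ doublyStochastic ℝ (Fin (k + q)) := by
      rw [mem_doublyStochastic_iff_sum]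
      refine ⟨fun i l => ?_, fun i => ?_, fun l => ?_⟩
      · refine Fin.addCases (fun l => ?_) (fun j => ?_) l
        · rw [hP1]
          exact div_nonneg (by linarith [sum_sq_row_le_one hW i]) hk0.le
        · rw [hP2]; positivity
      · rw [Fin.sum_univ_add]
        simp only [hP1, hP2, Finset.sum_const, Finset.card_univ, Fintype.card_fin, nsmul_eq_mul]
        field_simp
        ring
      · refine Fin.addCases (fun l => ?_) (fun j => ?_) l
        · simp only [hP1]
          rw [← Finset.sum_div, Finset.sum_sub_distrib, Finset.sum_comm]
          simp only [hcol, Finset.sum_const, Finset.card_univ, Fintype.card_fin, nsmul_eq_mul]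
          push_cast
          field_simp
          ring
        · simp only [hP2, hcol]
    -- Padding with zeros at the bottom keeps `lam` monotone because `lam ≥ 0`, and hides the
    -- artificial columns of `P`.
    let L : Fin (k + q) → ℝ := Fin.addCases (fun _ => 0) lam
    have hL1 : ∀ l, L (Fin.castAdd q l) = 0 := by simp [L]
    have hL2 : ∀ j, L (Fin.natAdd k j) = lam j := by simp [L]
    have hL : Monotone L := by
      intro a b
      refine Fin.addCases (fun a => ?_) (fun a => ?_) a <;>
        refine Fin.addCases (fun b => ?_) (fun b => ?_) b <;> intro hab
      · rw [hL1, hL1]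
      · rw [hL1, hL2]; exact hlam0 b
      · exfalso
        have := a.isLt; have := b.isLt
        simp only [Fin.le_def, Fin.val_natAdd, Fin.val_castAdd] at hab
        omega
      · rw [hL2, hL2]; exact hlam (by simpa using hab)
    have key := sum_doublyStochastic_le hP (he.monovary hL)
    simp only [Fin.sum_univ_add (f := fun l => P _ l * (e _ * L l)), hL1, hL2, hP2, mul_zero,
      Finset.sum_const_zero, zero_add] at key
    rw [Fin.sum_univ_add (f := fun i => e i * L i)] at key
    simp only [hL1, hL2, mul_zero, Finset.sum_const_zero, zero_add] at key
    rw [Finset.sum_comm] at key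
    calc _ = ∑ j, ∑ i, W i j ^ 2 * (e i * lam j) := by
          refine Finset.sum_congr rfl fun j _ => ?_
          rw [hWjj, Finset.mul_sum]
          exact Finset.sum_congr rfl fun i _ => by ring
      _ ≤ _ := key
      _ = _ := Finset.sum_congr rfl fun j _ => mul_comm _ _

end Eigenvectors

/-! ### Decrease of the objective -/

section Objective

variable {p q : ℕ}

theorem spectralMatrix_apply (U : Fin p → Fin q → ℝ) (lam : Fin q → ℝ) (i j : Fin p) :
    spectralMatrix U lam i j = ∑ l, U i l * lam l * U j l := by
  rw [spectralMatrix, Matrix.mul_apply]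
  exact Finset.sum_congr rfl fun l _ => by rw [Matrix.mul_diagonal]; rfl

theorem sum_mul_spectralMatrix (A : Matrix (Fin p) (Fin p) ℝ) (U : Fin p → Fin q → ℝ)
    (lam : Fin q → ℝ) : ∑ i, ∑ j, A i j * spectralMatrix U lam i j
      = ∑ l, lam l * ((Matrix.of U)ᵀ * A * Matrix.of U) l l := by
  simp only [spectralMatrix_apply, Matrix.mul_apply, Matrix.transpose_apply, Matrix.of_apply,
    Finset.mul_sum, Finset.sum_mul]
  rw [Finset.sum_comm]
  rw [Finset.sum_congr rfl fun j _ => Finset.sum_comm, Finset.sum_comm]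
  exact Finset.sum_congr rfl fun l _ => Finset.sum_congr rfl fun j _ =>
    Finset.sum_congr rfl fun i _ => by ring

theorem frobSq_sub_spectralMatrix (A : Matrix (Fin p) (Fin p) ℝ) {U : Fin p → Fin q → ℝ}
    (hU : (Matrix.of U)ᵀ * Matrix.of U = 1) (lam : Fin q → ℝ) :
    frobSq (A - spectralMatrix U lam)
      = frobSq A + ∑ l, (lam l ^ 2 - 2 * lam l * ((Matrix.of U)ᵀ * A * Matrix.of U) l l) := by
  have h1 : frobSq (A - spectralMatrix U lam) = frobSq A
      - 2 * ∑ i, ∑ j, A i j * spectralMatrix U lam i j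
      + ∑ i, ∑ j, spectralMatrix U lam i j * spectralMatrix U lam i j := by
    simp only [frobSq, Finset.mul_sum, ← Finset.sum_add_distrib, ← Finset.sum_sub_distrib,
      Matrix.sub_apply]
    exact Finset.sum_congr rfl fun i _ => Finset.sum_congr rfl fun j _ => by ring
  have h2 : (Matrix.of U)ᵀ * spectralMatrix U lam * Matrix.of U = Matrix.diagonal lam := by
    rw [spectralMatrix, ← Matrix.mul_assoc, ← Matrix.mul_assoc, hU, Matrix.one_mul,
      Matrix.mul_assoc, hU, Matrix.mul_one]
  rw [h1, sum_mul_spectralMatrix, sum_mul_spectralMatrix, h2, Finset.mul_sum, sub_add,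
    ← Finset.sum_sub_distrib, sub_eq_add_neg, ← Finset.sum_neg_distrib]
  congr 1
  refine Finset.sum_congr rfl fun l _ => ?_
  rw [Matrix.diagonal_apply_eq]; ring

/-- Orthonormality gives `‖U Diag(λ) Uᵀ‖² = ∑ λ_i²`. For fixed `w` the objective then separates over
the `λ_i`, and `U` enters only through `spectralTarget`. -/
theorem objective_eq (S : Matrix (Fin p) (Fin p) ℝ) (α β : ℝ) {w : Edge p → ℝ}
    {U : Fin p → Fin q → ℝ} {lam : Fin q → ℝ} (hU : (Matrix.of U)ᵀ * Matrix.of U = 1)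
    (hlam : ∀ i, 0 < lam i) :
    objective S α β (w, U, lam) = (dataMatrix S α * lap w).trace + β / 2 * frobSq (lap w)
      + ∑ i, (-Real.log (lam i)
        + β / 2 * (lam i ^ 2 - 2 * lam i * spectralTarget w U i)) := by
  rw [objective, frobSq_sub_spectralMatrix _ hU, Matrix.det_diagonal,
    Real.log_prod fun i _ => (hlam i).ne']
  simp only [Finset.sum_add_distrib, ← Finset.mul_sum, Finset.sum_neg_distrib, spectralTarget]
  ring

/-- What the steps in `U` and `lam` guarantee, phrased as closed conditions. -/
structure IsSpectralPoint (β c₁ c₂ : ℝ) (x : Point p q) : Prop where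
  w_nonneg : ∀ e, 0 ≤ x.1 e
  orth : (Matrix.of x.2.1)ᵀ * Matrix.of x.2.1 = 1
  eigen : lap x.1 * Matrix.of x.2.1 = Matrix.of x.2.1 * Matrix.diagonal (spectralTarget x.1 x.2.1)
  mono : Monotone (spectralTarget x.1 x.2.1)
  lam_eq : ∀ i, x.2.2 i = isoClamp β c₁ c₂ (spectralTarget x.1 x.2.1 i)

theorem IsSpectralPoint.lam_mem {β c₁ c₂ : ℝ} (hβ : 0 < β) (hc : c₁ ≤ c₂) {x : Point p q}
    (hx : IsSpectralPoint β c₁ c₂ x) : x.2.2 ∈ spectralSet q c₁ c₂ := by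
  refine ⟨fun i j hij => ?_, fun i => ?_⟩
  · rw [hx.lam_eq, hx.lam_eq]; exact isoClamp_mono hβ (hx.mono hij)
  · rw [hx.lam_eq]; exact ⟨le_isoClamp _, isoClamp_le hc _⟩

theorem continuous_spectralTarget :
    Continuous fun x : Point p q => spectralTarget x.1 x.2.1 := by
  have := continuous_lap (p := p)
  unfold spectralTarget
  refine continuous_pi fun i => Continuous.matrix_elem ?_ i i
  fun_prop

theorem continuous_spectralMatrix :
    Continuous fun x : Point p q => spectralMatrix x.2.1 x.2.2 := by
  unfold spectralMatrix
  fun_prop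

theorem continuous_updateW (S : Matrix (Fin p) (Fin p) ℝ) (α β : ℝ) :
    Continuous (updateW S α β : Point p q → Edge p → ℝ) := by
  have h1 := continuous_lap (p := p)
  have h2 := continuous_lapAdj (p := p)
  have h3 := continuous_spectralMatrix (p := p) (q := q)
  unfold updateW gradW
  fun_prop

/-- Lets limit points inherit the conditions, all of which are equations or weak inequalities
between continuous functions. -/
theorem isClosed_setOf_isSpectralPoint (β c₁ c₂ : ℝ) :
    IsClosed {x : Point p q | IsSpectralPoint β c₁ c₂ x} := by
  have h1 := continuous_lap (p := p)
  have h2 := continuous_spectralTarget (p := p) (q := q)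
  have h3 := continuous_isoClamp (β := β) (c₁ := c₁) (c₂ := c₂)
  have : {x : Point p q | IsSpectralPoint β c₁ c₂ x} =
      {x | ∀ e, 0 ≤ x.1 e} ∩ {x | (Matrix.of x.2.1)ᵀ * Matrix.of x.2.1 = 1} ∩
      {x | lap x.1 * Matrix.of x.2.1
        = Matrix.of x.2.1 * Matrix.diagonal (spectralTarget x.1 x.2.1)} ∩
      {x | ∀ i j, i ≤ j → spectralTarget x.1 x.2.1 i ≤ spectralTarget x.1 x.2.1 j} ∩
      {x | ∀ i, x.2.2 i = isoClamp β c₁ c₂ (spectralTarget x.1 x.2.1 i)} := by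
    ext x
    exact ⟨fun h => ⟨⟨⟨⟨h.1, h.2⟩, h.3⟩, fun _ _ hij => h.4 hij⟩, h.5⟩,
      fun h => ⟨h.1.1.1.1, h.1.1.1.2, h.1.1.2, fun _ _ hij => h.1.2 _ _ hij, h.2⟩⟩
  rw [this]
  have h2' : ∀ i, Continuous fun x : Point p q => spectralTarget x.1 x.2.1 i := fun i =>
    continuous_pi_iff.1 h2 i
  refine (((IsClosed.inter ?_ ?_).inter ?_).inter ?_).inter ?_
  · simp only [Set.ofPred_forall]
    exact isClosed_iInter fun e => isClosed_le continuous_const (by fun_prop)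
  · exact isClosed_eq (by fun_prop) continuous_const
  · exact isClosed_eq (by fun_prop) (by fun_prop)
  · simp only [Set.ofPred_forall]
    exact isClosed_iInter fun i => isClosed_iInter fun j => isClosed_iInter fun _ =>
      isClosed_le (h2' i) (h2' j)
  · simp only [Set.ofPred_forall]
    exact isClosed_iInter fun i => isClosed_eq (by fun_prop) (h3.comp (h2' i))

end Objective

/-! ### Descent along the iterates -/

section Descent

variable {k q : ℕ} {S : Matrix (Fin (k + q)) (Fin (k + q)) ℝ} {α β c₁ c₂ : ℝ}
  {x : ℕ → Point (k + q) q}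

theorem spectralTarget_eq_of_mul_eq {p : ℕ} {w : Edge p → ℝ} {U : Fin p → Fin q → ℝ}
    {e : Fin q → ℝ} (hU : (Matrix.of U)ᵀ * Matrix.of U = 1)
    (he : lap w * Matrix.of U = Matrix.of U * Matrix.diagonal e) : spectralTarget w U = e := by
  ext i
  rw [spectralTarget, Matrix.mul_assoc, he, ← Matrix.mul_assoc, hU, Matrix.one_mul,
    Matrix.diagonal_apply_eq]

theorem IsSGLSequence.isSpectralPoint (hk : 1 ≤ k) (hβ : 0 < β) (hc : c₁ ≤ c₂)
    (hx : IsSGLSequence S α β c₁ c₂ x) (t : ℕ) : IsSpectralPoint β c₁ c₂ (x (t + 1)) := by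
  obtain ⟨h1, h2, h3⟩ := hx t
  obtain ⟨e, he, hU, hA, -⟩ := h2.exists_eigenvalues hk
  have hd := spectralTarget_eq_of_mul_eq hU hA
  have hmono : Monotone (spectralTarget (x (t + 1)).1 (x (t + 1)).2.1) := hd ▸ he
  refine ⟨fun e => ?_, hU, by rw [hd, hA], hmono, fun i => ?_⟩
  · rw [h1]; exact le_max_right _ _
  · exact congrFun (h3.eq_isoClamp hβ hc hmono) i

theorem IsSGLSequence.objective_add_le (hk : 1 ≤ k) (hβ : 0 < β) (hc₁ : 0 < c₁) (hc : c₁ ≤ c₂)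
    (hx : IsSGLSequence S α β c₁ c₂ x) {t : ℕ} (ht : IsSpectralPoint β c₁ c₂ (x t)) :
    objective S α β (x (t + 1))
      + β * (k + q : ℕ) * ∑ e, ((x (t + 1)).1 e - (x t).1 e) ^ 2 ≤ objective S α β (x t) := by
  have ht' := hx.isSpectralPoint hk hβ hc t
  obtain ⟨h1, h2, -⟩ := hx t
  have hW := objective_updateW_le (by omega) S (α := α) hβ (x t) ht.w_nonneg
  rw [← h1] at hW
  have hlam := ht.lam_mem hβ hc
  have hlam' := ht'.lam_mem hβ hc
  obtain ⟨e, he, hU, hA, hmax⟩ := h2.exists_eigenvalues hk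
  have hd := spectralTarget_eq_of_mul_eq hU hA
  have hUstep := hmax _ ht.orth _ hlam.1 fun i => hc₁.le.trans (hlam.2 i).1
  rw [← hd] at hUstep
  -- The intermediate point has the new `U` and the old `λ`: `hR` is the eigenvector step, `hL` the
  -- step in `λ`.
  have hobj : objective S α β (x (t + 1)) ≤ objective S α β ((x (t + 1)).1, (x t).2) := by
    have e1 := objective_eq S α β (w := (x (t + 1)).1) ht'.orth
      fun i => hc₁.trans_le (hlam'.2 i).1
    have e2 := objective_eq S α β (w := (x (t + 1)).1) ht.orth fun i => hc₁.trans_le (hlam.2 i).1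
    change objective S α β ((x (t + 1)).1, (x (t + 1)).2.1, (x (t + 1)).2.2)
      ≤ objective S α β ((x (t + 1)).1, (x t).2.1, (x t).2.2)
    rw [e1, e2]
    have hL : ∑ i, (-Real.log ((x (t + 1)).2.2 i) + β / 2 * ((x (t + 1)).2.2 i ^ 2
          - 2 * (x (t + 1)).2.2 i * spectralTarget (x (t + 1)).1 (x (t + 1)).2.1 i))
        ≤ ∑ i, (-Real.log ((x t).2.2 i) + β / 2 * ((x t).2.2 i ^ 2
          - 2 * (x t).2.2 i * spectralTarget (x (t + 1)).1 (x (t + 1)).2.1 i)) := by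
      refine Finset.sum_le_sum fun i _ => ?_
      rw [ht'.lam_eq i]
      exact isoClamp_isMinOn hβ hc₁ hc _ (hlam.2 i).1 (hlam.2 i).2
    have hR : ∑ i, (-Real.log ((x t).2.2 i) + β / 2 * ((x t).2.2 i ^ 2
          - 2 * (x t).2.2 i * spectralTarget (x (t + 1)).1 (x (t + 1)).2.1 i))
        ≤ ∑ i, (-Real.log ((x t).2.2 i) + β / 2 * ((x t).2.2 i ^ 2
          - 2 * (x t).2.2 i * spectralTarget (x (t + 1)).1 (x t).2.1 i)) := by
      have := mul_le_mul_of_nonneg_left hUstep hβ.le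
      rw [Finset.mul_sum, Finset.mul_sum] at this
      rw [← sub_nonneg, ← Finset.sum_sub_distrib] at this ⊢
      refine this.trans (le_of_eq (Finset.sum_congr rfl fun i _ => ?_))
      simp only [spectralTarget]; ring
    linarith
  linarith

end Descent

/-! ### KKT points -/

section KKT

/-- Take `μ_i = ∑_{j ≥ i} g_j⁺ + ∑_{j < i} g_j⁻`, so that consecutive differences telescope to
`g_j`. If `g_j > 0`, then `λ_j = c₁`, which forces equality in all chain constraints `i ≤ j`; if
`g_j < 0`, then `λ_j = c₂` does so for `i > j`. Hence complementary slackness holds term by term. -/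
theorem exists_chain_multipliers {q : ℕ} {c₁ c₂ : ℝ} {lam g : Fin q → ℝ}
    (hlam : lam ∈ spectralSet q c₁ c₂) (h1 : ∀ j, lam j = c₁ ∨ g j ≤ 0)
    (h2 : ∀ j, lam j = c₂ ∨ 0 ≤ g j) :
    ∃ μ : Fin (q + 1) → ℝ, (∀ i, 0 ≤ μ i) ∧ (∀ i, μ i * chainConstraint c₁ c₂ lam i = 0) ∧
      ∀ j : Fin q, g j + μ j.succ - μ j.castSucc = 0 := by
  refine ⟨fun i => ∑ j : Fin q, if (i : ℕ) ≤ j then max (g j) 0 else max (-g j) 0,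
    fun i => ?_, fun i => ?_, fun j => ?_⟩
  · exact Finset.sum_nonneg fun j _ => by split_ifs <;> exact le_max_right _ _
  · have hcons : (Fin.cons c₁ lam : Fin (q + 1) → ℝ) i = c₁ ∧ (i : ℕ) = 0 ∨
        ∃ a : Fin q, (i : ℕ) = a + 1 ∧ (Fin.cons c₁ lam : Fin (q + 1) → ℝ) i = lam a := by
      refine Fin.cases (Or.inl ⟨rfl, rfl⟩) (fun a => Or.inr ⟨a, ?_, ?_⟩) i <;> simp
    have hsnoc : (Fin.snoc lam c₂ : Fin (q + 1) → ℝ) i = c₂ ∧ (i : ℕ) = q ∨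
        ∃ b : Fin q, (i : ℕ) = b ∧ (Fin.snoc lam c₂ : Fin (q + 1) → ℝ) i = lam b := by
      refine Fin.lastCases (Or.inl ⟨by simp, by simp⟩) (fun b => Or.inr ⟨b, ?_, ?_⟩) i <;> simp
    have hzero : ∀ j : Fin q, (if (i : ℕ) ≤ j then max (g j) 0 else max (-g j) 0) = 0 ∨
        chainConstraint c₁ c₂ lam i = 0 := by
      intro j
      have hj := hlam.2 j
      split_ifs with hij
      · rcases h1 j with hj1 | hj1
        · right
          have e1 : (Fin.cons c₁ lam : Fin (q + 1) → ℝ) i = c₁ := by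
            rcases hcons with h | ⟨a, ha, h⟩
            · exact h.1
            · rw [h]
              exact le_antisymm ((hlam.1 (Fin.le_def.2 (by omega))).trans hj1.le) (hlam.2 a).1
          have e2 : (Fin.snoc lam c₂ : Fin (q + 1) → ℝ) i = c₁ := by
            rcases hsnoc with h | ⟨a, ha, h⟩
            · have := j.isLt; omega
            · rw [h]
              exact le_antisymm ((hlam.1 (Fin.le_def.2 (by omega))).trans hj1.le) (hlam.2 a).1
          rw [chainConstraint, e1, e2, sub_self]
        · left; exact max_eq_right hj1
      · rcases h2 j with hj2 | hj2
        · right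
          have e1 : (Fin.cons c₁ lam : Fin (q + 1) → ℝ) i = c₂ := by
            rcases hcons with h | ⟨a, ha, h⟩
            · omega
            · rw [h]
              exact le_antisymm (hlam.2 a).2 (hj2.ge.trans (hlam.1 (Fin.le_def.2 (by omega))))
          have e2 : (Fin.snoc lam c₂ : Fin (q + 1) → ℝ) i = c₂ := by
            rcases hsnoc with h | ⟨a, ha, h⟩
            · exact h.1
            · rw [h]
              exact le_antisymm (hlam.2 a).2 (hj2.ge.trans (hlam.1 (Fin.le_def.2 (by omega))))
          rw [chainConstraint, e1, e2, sub_self]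
        · left; exact max_eq_right (by linarith)
    rw [Finset.sum_mul]
    exact Finset.sum_eq_zero fun j _ => mul_eq_zero.2 (hzero j)
  · rw [add_sub_assoc, ← Finset.sum_sub_distrib, Finset.sum_eq_single j]
    · simp only [Fin.val_succ, Fin.val_castSucc, le_refl, if_true]
      rw [if_neg (by omega)]
      rcases le_total 0 (g j) with h | h
      · rw [max_eq_left h, max_eq_right (by linarith)]; ring
      · rw [max_eq_right h, max_eq_left (by linarith)]; ring
    · intro b _ hb
      have hb' : (b : ℕ) ≠ j := fun h => hb (Fin.ext h)
      simp only [Fin.val_succ, Fin.val_castSucc]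
      by_cases h : (j : ℕ) ≤ b
      · rw [if_pos h, if_pos (by omega), sub_self]
      · rw [if_neg h, if_neg (by omega), sub_self]
    · simp

end KKT

/-! ### The derivative of the Lagrangian -/

section Lagrangian

variable {p q : ℕ}

theorem sum_mul_chainConstraint (c₁ c₂ : ℝ) (μ : Fin (q + 1) → ℝ) (lam : Fin q → ℝ) :
    ∑ i, μ i * chainConstraint c₁ c₂ lam i
      = ∑ j : Fin q, (μ j.succ - μ j.castSucc) * lam j + (μ 0 * c₁ - μ (Fin.last q) * c₂) := by
  simp only [chainConstraint, mul_sub, Finset.sum_sub_distrib, sub_mul]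
  rw [Fin.sum_univ_succ, Fin.sum_univ_castSucc (f := fun i => μ i * (Fin.snoc lam c₂ : _ → ℝ) i)]
  simp only [Fin.cons_zero, Fin.cons_succ, Fin.snoc_castSucc, Fin.snoc_last]
  ring

/-- The Lagrangian in coordinates, for positive `lam`. -/
theorem lagrangian_eq (S : Matrix (Fin p) (Fin p) ℝ) (α β c₁ c₂ : ℝ)
    (μ₁ : Edge p → ℝ) (μ₂ : Fin (q + 1) → ℝ) (m : Fin q → ℝ) {x : Point p q}
    (hx : ∀ i, 0 < x.2.2 i) :
    lagrangian S α β c₁ c₂ μ₁ μ₂ (Matrix.diagonal m) x =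
      -∑ i, Real.log (x.2.2 i) + ∑ e, x.1 e * lapAdj (dataMatrix S α) e
      + β / 2 * ∑ i, ∑ j, (lap x.1 i j - ∑ l, x.2.1 i l * x.2.2 l * x.2.1 j l) ^ 2
      - ∑ e, μ₁ e * x.1 e
      + (∑ j : Fin q, (μ₂ j.succ - μ₂ j.castSucc) * x.2.2 j
        + (μ₂ 0 * c₁ - μ₂ (Fin.last q) * c₂))
      + ∑ l, m l * (∑ i, x.2.1 i l ^ 2 - 1) := by
  have htr : ((Matrix.diagonal m)ᵀ * ((Matrix.of x.2.1)ᵀ * Matrix.of x.2.1 - 1)).trace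
      = ∑ l, m l * (∑ i, x.2.1 i l ^ 2 - 1) := by
    rw [Matrix.diagonal_transpose, Matrix.trace]
    refine Finset.sum_congr rfl fun l _ => ?_
    rw [Matrix.diag_apply, Matrix.diagonal_mul]
    simp [Matrix.mul_apply, sq]
  rw [lagrangian, objective, Matrix.det_diagonal, Real.log_prod fun i _ => (hx i).ne',
    trace_mul_lap, sum_mul_chainConstraint, htr]
  simp only [frobSq, Matrix.sub_apply, spectralMatrix_apply]

theorem differentiable_lap_apply (i j : Fin p) :
    Differentiable ℝ fun w : Edge p → ℝ => lap w i j := by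
  let φ : (Edge p → ℝ) →ₗ[ℝ] ℝ :=
    { toFun := fun w => lap w i j
      map_add' := fun w v => by rw [lap_add]; rfl
      map_smul' := fun c w => by rw [lap_smul]; rfl }
  exact φ.toContinuousLinearMap.differentiable

/-- Differentiability is qualitative, so the derivative vanishes once all directional derivatives
do; the hypothesis `h` is the derivative along `(δ, E, l)`. A diagonal `M` is enough because `U`
consists of eigenvectors in the application. -/
theorem hasFDerivAt_lagrangian (S : Matrix (Fin p) (Fin p) ℝ) (α β c₁ c₂ : ℝ)
    (μ₁ : Edge p → ℝ) (μ₂ : Fin (q + 1) → ℝ) (m : Fin q → ℝ) {w : Edge p → ℝ}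
    {U : Fin p → Fin q → ℝ} {lam : Fin q → ℝ} (hlam : ∀ i, 0 < lam i)
    (h : ∀ (δ : Edge p → ℝ) (E : Fin p → Fin q → ℝ) (l : Fin q → ℝ),
      -∑ i, l i / lam i + ∑ e, δ e * lapAdj (dataMatrix S α) e
      + β * ∑ i, ∑ j, (lap w - spectralMatrix U lam) i j * (lap δ i j -
        ∑ r, ((E i r * lam r + U i r * l r) * U j r + U i r * lam r * E j r))
      - ∑ e, μ₁ e * δ e + ∑ j : Fin q, (μ₂ j.succ - μ₂ j.castSucc) * l j
      + ∑ r, m r * ∑ i, 2 * U i r * E i r = 0) :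
    HasFDerivAt (lagrangian S α β c₁ c₂ μ₁ μ₂ (Matrix.diagonal m))
      (0 : Point p q →L[ℝ] ℝ) (w, U, lam) := by
  let G : Point p q → ℝ := fun x =>
    -∑ i, Real.log (x.2.2 i) + ∑ e, x.1 e * lapAdj (dataMatrix S α) e
      + β / 2 * ∑ i, ∑ j, (lap x.1 i j - ∑ l, x.2.1 i l * x.2.2 l * x.2.1 j l) ^ 2
      - ∑ e, μ₁ e * x.1 e
      + (∑ j : Fin q, (μ₂ j.succ - μ₂ j.castSucc) * x.2.2 j
        + (μ₂ 0 * c₁ - μ₂ (Fin.last q) * c₂))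
      + ∑ l, m l * (∑ i, x.2.1 i l ^ 2 - 1)
  -- Only a local identity: splitting the logarithm of the determinant uses `λ > 0`.
  have hG : lagrangian S α β c₁ c₂ μ₁ μ₂ (Matrix.diagonal m) =ᶠ[𝓝 (w, U, lam)] G := by
    have hpos : ∀ᶠ x : Point p q in 𝓝 (w, U, lam), ∀ i, 0 < x.2.2 i := by
      rw [eventually_all]
      intro i
      have hcont : Continuous fun x : Point p q => x.2.2 i := by fun_prop
      exact hcont.continuousAt.eventually (lt_mem_nhds (hlam i))
    filter_upwards [hpos] with x hx
    exact lagrangian_eq S α β c₁ c₂ μ₁ μ₂ m hx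
  have hlap := fun i j => differentiable_lap_apply (p := p) i j
  have hdiff : DifferentiableAt ℝ G (w, U, lam) := by
    have hlap' : ∀ i j, Differentiable ℝ fun x : Point p q => lap x.1 i j := fun i j =>
      (hlap i j).comp differentiable_fst
    have hlog : ∀ i, DifferentiableAt ℝ (fun x : Point p q => Real.log (x.2.2 i)) (w, U, lam) :=
      fun i => DifferentiableAt.log (by fun_prop) (hlam i).ne'
    fun_prop
  have hline : ∀ v, HasLineDerivAt ℝ G 0 (w, U, lam) v := by
    rintro ⟨δ, E, l⟩
    have haff : ∀ a b : ℝ, HasDerivAt (fun t => a + t * b) b 0 := fun a b => by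
      simpa using ((hasDerivAt_id (0 : ℝ)).mul_const b).const_add a
    have hX : ∀ i j, HasDerivAt (fun t : ℝ => (lap w i j + t * lap δ i j) -
          ∑ r, (U i r + t * E i r) * (lam r + t * l r) * (U j r + t * E j r))
        (lap δ i j -
          ∑ r, ((E i r * lam r + U i r * l r) * U j r + U i r * lam r * E j r)) 0 := by
      intro i j
      refine (haff _ _).sub (HasDerivAt.fun_sum fun r _ => ?_)
      simpa using
        ((haff (U i r) (E i r)).fun_mul (haff (lam r) (l r))).fun_mul (haff (U j r) (E j r))
    have hsq : ∀ i j, HasDerivAt (fun t : ℝ => ((lap w i j + t * lap δ i j) -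
          ∑ r, (U i r + t * E i r) * (lam r + t * l r) * (U j r + t * E j r)) ^ 2)
        (2 * ((lap w - spectralMatrix U lam) i j * (lap δ i j -
          ∑ r, ((E i r * lam r + U i r * l r) * U j r + U i r * lam r * E j r)))) 0 := by
      intro i j
      simpa [spectralMatrix_apply, mul_assoc] using (hX i j).fun_pow 2
    have hlog : HasDerivAt (fun t : ℝ => ∑ i, Real.log (lam i + t * l i)) (∑ i, l i / lam i) 0 :=
      HasDerivAt.fun_sum fun i _ => by
        simpa using (haff (lam i) (l i)).log (by simpa using (hlam i).ne')
    have hw1 : HasDerivAt (fun t : ℝ => ∑ e, (w e + t * δ e) * lapAdj (dataMatrix S α) e)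
        (∑ e, δ e * lapAdj (dataMatrix S α) e) 0 :=
      HasDerivAt.fun_sum fun e _ => (haff _ _).mul_const _
    have hw2 : HasDerivAt (fun t : ℝ => ∑ e, μ₁ e * (w e + t * δ e)) (∑ e, μ₁ e * δ e) 0 :=
      HasDerivAt.fun_sum fun e _ => (haff _ _).const_mul _
    have hl : HasDerivAt (fun t : ℝ => ∑ j : Fin q, (μ₂ j.succ - μ₂ j.castSucc) *
        (lam j + t * l j)) (∑ j : Fin q, (μ₂ j.succ - μ₂ j.castSucc) * l j) 0 :=
      HasDerivAt.fun_sum fun e _ => (haff _ _).const_mul _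
    have hm : HasDerivAt (fun t : ℝ => ∑ r, m r * (∑ i, (U i r + t * E i r) ^ 2 - 1))
        (∑ r, m r * ∑ i, 2 * U i r * E i r) 0 := by
      refine HasDerivAt.fun_sum fun r _ => HasDerivAt.const_mul _ ?_
      refine HasDerivAt.sub_const _ (HasDerivAt.fun_sum fun i _ => ?_)
      simpa using (haff (U i r) (E i r)).fun_pow 2
    have hfrob := (HasDerivAt.fun_sum fun i (_ : i ∈ Finset.univ) =>
      HasDerivAt.fun_sum fun j (_ : j ∈ Finset.univ) => hsq i j).const_mul (β / 2)
    have hall := ((((hlog.neg.add hw1).add hfrob).sub hw2).add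
      (hl.add_const (μ₂ 0 * c₁ - μ₂ (Fin.last q) * c₂))).add hm
    unfold HasLineDerivAt
    refine (hall.congr_of_eventuallyEq (Eventually.of_forall fun t => ?_)).congr_deriv ?_
    · simp only [G, Prod.smul_mk, Prod.mk_add_mk, lap_add, lap_smul, Pi.add_apply, Pi.smul_apply,
        Pi.sub_apply, Pi.neg_apply, Matrix.add_apply, Matrix.smul_apply, smul_eq_mul]
    · rw [← h δ E l]
      simp only [← Finset.mul_sum]
      ring
  have hzero : fderiv ℝ G (w, U, lam) = 0 := by
    refine ContinuousLinearMap.ext fun v => ?_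
    rw [← hdiff.lineDeriv_eq_fderiv, (hline v).lineDeriv]; rfl
  exact (hzero ▸ hdiff.hasFDerivAt).congr_of_eventuallyEq hG

end Lagrangian

/-- A spectral point that is fixed by the projected gradient step is a KKT point. -/
theorem IsSpectralPoint.isKKT {p q : ℕ} (hp : 0 < p) {S : Matrix (Fin p) (Fin p) ℝ}
    {α β c₁ c₂ : ℝ} (hβ : 0 < β) (hc₁ : 0 < c₁) (hc : c₁ ≤ c₂) {x : Point p q}
    (hx : IsSpectralPoint β c₁ c₂ x) (hfix : updateW S α β x = x.1) : IsKKT S α β c₁ c₂ x := by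
  have hmem := hx.lam_mem hβ hc
  obtain ⟨w, U, lam⟩ := x
  obtain ⟨hw, hU, hA, hmono, hlam⟩ := hx
  simp only at hw hU hA hmono hlam hfix hmem
  set d := spectralTarget w U with hd
  set g := gradW S α β (w, U, lam) with hg
  have hpos : ∀ i, 0 < lam i := fun i => hc₁.trans_le (hmem.2 i).1
  have hgrad : ∀ e, 0 ≤ g e ∧ g e * w e = 0 := fun e =>
    eq_projectedStep (by exact_mod_cast hp) (congrFun hfix e)
  obtain ⟨μ₂, hμ0, hμs, hμg⟩ := exists_chain_multipliers
    (g := fun j => β * (lam j - d j) - 1 / lam j) hmem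
    (fun j => hlam j ▸ isoClamp_eq_left_or hβ hc₁ _)
    (fun j => hlam j ▸ isoClamp_eq_right_or hβ hc _)
  -- The `w`-gradient of the objective is `βg`. Its `U`-gradient is `-2βXU Diag(λ)`, where `X = 𝓛w -
  -- U Diag(λ)Uᵀ` satisfies `XU = U Diag(d - λ)`; it must cancel `2UM`, which dictates `M`.
  refine ⟨hw, hmem, hU, fun e => β * g e, μ₂,
    Matrix.diagonal fun r => β * ((d r - lam r) * lam r), fun e => mul_nonneg hβ.le (hgrad e).1,
    hμ0, fun e => ?_, hμs, ?_⟩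
  · simp only; rw [mul_assoc, (hgrad e).2, mul_zero]
  refine hasFDerivAt_lagrangian S α β c₁ c₂ _ μ₂ _ hpos fun δ E l => ?_
  set X := lap w - spectralMatrix U lam with hX
  have hXsym : ∀ i j, X i j = X j i := by
    intro i j
    have h1 : lap w i j = lap w j i := by
      rw [← Matrix.transpose_apply (lap w), lap_transpose]
    simp only [hX, Matrix.sub_apply, h1, spectralMatrix_apply]
    congr 1
    exact Finset.sum_congr rfl fun r _ => by ring
  have hXU : ∀ i r, ∑ j, X i j * U j r = U i r * (d r - lam r) := by
    intro i r
    have h1 : X * Matrix.of U = Matrix.of U * Matrix.diagonal (fun r => d r - lam r) := by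
      rw [hX, Matrix.sub_mul, hA, spectralMatrix, Matrix.mul_assoc _ _ (Matrix.of U), hU,
        Matrix.mul_one, ← Matrix.mul_sub, Matrix.diagonal_sub]
    have := congrFun (congrFun h1 i) r
    rw [Matrix.mul_apply, Matrix.mul_diagonal] at this
    exact this
  have hcol : ∀ r, ∑ i, U i r * U i r = 1 := by
    intro r
    have := congrFun (congrFun hU r) r
    simpa [Matrix.mul_apply] using this
  have hE2 : ∑ i, ∑ j, X i j * ∑ r, U i r * lam r * E j r
      = ∑ r, ∑ j, U j r * E j r * ((d r - lam r) * lam r) := by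
    calc _ = ∑ j, ∑ r, ∑ i, X j i * U i r * (lam r * E j r) := by
          rw [Finset.sum_comm]
          refine Finset.sum_congr rfl fun j _ => ?_
          rw [Finset.sum_comm]
          refine Finset.sum_congr rfl fun i _ => ?_
          rw [Finset.mul_sum, hXsym]
          exact Finset.sum_congr rfl fun r _ => by ring
      _ = _ := by
          rw [Finset.sum_comm]
          refine Finset.sum_congr rfl fun r _ => Finset.sum_congr rfl fun j _ => ?_
          rw [← Finset.sum_mul, hXU]; ring
  have hE1 : ∑ i, ∑ j, X i j * ∑ r, E i r * lam r * U j r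
      = ∑ r, ∑ j, U j r * E j r * ((d r - lam r) * lam r) := by
    rw [← hE2, Finset.sum_comm]
    refine Finset.sum_congr rfl fun i _ => Finset.sum_congr rfl fun j _ => ?_
    rw [hXsym]
    congr 1
    exact Finset.sum_congr rfl fun r _ => by ring
  have hl : ∑ i, ∑ j, X i j * ∑ r, U i r * l r * U j r = ∑ r, l r * (d r - lam r) := by
    calc _ = ∑ i, ∑ r, ∑ j, X i j * U j r * (U i r * l r) := by
          refine Finset.sum_congr rfl fun i _ => ?_
          rw [Finset.sum_comm]
          refine Finset.sum_congr rfl fun j _ => ?_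
          rw [Finset.mul_sum]
          exact Finset.sum_congr rfl fun r _ => by ring
      _ = ∑ r, ∑ i, U i r * U i r * (l r * (d r - lam r)) := by
          rw [Finset.sum_comm]
          refine Finset.sum_congr rfl fun r _ => Finset.sum_congr rfl fun j _ => ?_
          rw [← Finset.sum_mul, hXU]; ring
      _ = _ := by
          refine Finset.sum_congr rfl fun r _ => ?_
          rw [← Finset.sum_mul, hcol, one_mul]
  have hXX : ∑ i, ∑ j, X i j * (lap δ i j -
        ∑ r, ((E i r * lam r + U i r * l r) * U j r + U i r * lam r * E j r))
      = ∑ e, δ e * lapAdj X e - 2 * ∑ r, ∑ j, U j r * E j r * ((d r - lam r) * lam r)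
        - ∑ r, l r * (d r - lam r) := by
    rw [← sum_lap_mul, ← hl, two_mul]
    nth_rewrite 1 [← hE1]
    rw [← hE2]
    simp only [← Finset.sum_add_distrib, ← Finset.sum_sub_distrib]
    refine Finset.sum_congr rfl fun i _ => Finset.sum_congr rfl fun j _ => ?_
    simp only [add_mul, Finset.sum_add_distrib]
    ring
  have hwpart : ∑ e, δ e * lapAdj (dataMatrix S α) e + β * ∑ e, δ e * lapAdj X e
      - ∑ e, β * g e * δ e = 0 := by
    rw [Finset.mul_sum, ← Finset.sum_add_distrib, ← Finset.sum_sub_distrib]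
    refine Finset.sum_eq_zero fun e _ => ?_
    simp only [hg, hX, gradW, lapAdj_sub, lapAdj_smul, Pi.sub_apply, Pi.smul_apply, smul_eq_mul]
    field_simp
    ring
  have hmpart : ∑ r, β * ((d r - lam r) * lam r) * ∑ i, 2 * U i r * E i r
      = β * (2 * ∑ r, ∑ j, U j r * E j r * ((d r - lam r) * lam r)) := by
    simp only [Finset.mul_sum]
    exact Finset.sum_congr rfl fun r _ => Finset.sum_congr rfl fun i _ => by ring
  have hlpart : -∑ i, l i / lam i - β * ∑ r, l r * (d r - lam r)
      + ∑ j : Fin q, (μ₂ j.succ - μ₂ j.castSucc) * l j = 0 := by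
    rw [← Finset.sum_neg_distrib, Finset.mul_sum, ← Finset.sum_sub_distrib,
      ← Finset.sum_add_distrib]
    refine Finset.sum_eq_zero fun r _ => ?_
    linear_combination l r * hμg r
  rw [hXX, hmpart]
  linarith

/-! ### Boundedness and convergence -/

section Bounds

variable {p q : ℕ} {β c₁ c₂ : ℝ}

theorem abs_apply_le_one_of_orth {U : Fin p → Fin q → ℝ}
    (hU : (Matrix.of U)ᵀ * Matrix.of U = 1) (i : Fin p) (l : Fin q) : |U i l| ≤ 1 := by
  have h : ∑ i, U i l ^ 2 = 1 := by
    have := congrFun (congrFun hU l) l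
    simpa [Matrix.mul_apply, sq] using this
  have h1 : U i l ^ 2 ≤ 1 := h ▸ Finset.single_le_sum (f := fun i => U i l ^ 2)
    (fun _ _ => sq_nonneg _) (Finset.mem_univ i)
  exact abs_le_one_iff_mul_self_le_one.2 (by rwa [← sq])

theorem IsSpectralPoint.abs_spectralMatrix_le (hβ : 0 < β) (hc₁ : 0 < c₁) (hc : c₁ ≤ c₂)
    {x : Point p q} (hx : IsSpectralPoint β c₁ c₂ x) (i j : Fin p) :
    |spectralMatrix x.2.1 x.2.2 i j| ≤ q * c₂ := by
  have hmem := hx.lam_mem hβ hc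
  rw [spectralMatrix_apply]
  refine (Finset.abs_sum_le_sum_abs _ _).trans ?_
  have : ∀ l ∈ Finset.univ, |x.2.1 i l * x.2.2 l * x.2.1 j l| ≤ c₂ := by
    intro l _
    have hl := hmem.2 l
    rw [abs_mul, abs_mul, abs_of_pos (hc₁.trans_le hl.1)]
    have h1 := abs_apply_le_one_of_orth hx.orth i l
    have h2 := abs_apply_le_one_of_orth hx.orth j l
    calc |x.2.1 i l| * x.2.2 l * |x.2.1 j l| ≤ 1 * c₂ * 1 := by
          have := hl.2
          have : 0 ≤ x.2.2 l := hc₁.le.trans hl.1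
          gcongr
          linarith
      _ = c₂ := by ring
  simpa using Finset.sum_le_sum this

/-- The objective is coercive on spectral points. -/
theorem exists_le_objective (S : Matrix (Fin p) (Fin p) ℝ) (α : ℝ) (hβ : 0 < β) (hc₁ : 0 < c₁)
    (hc : c₁ ≤ c₂) : ∃ R : ℝ, ∀ x : Point p q, IsSpectralPoint β c₁ c₂ x →
      β / 4 * frobSq (lap x.1 - spectralMatrix x.2.1 x.2.2) - R ≤ objective S α β x := by
  set K := dataMatrix S α with hK
  -- The three terms pay for the log-determinant, for completing the square with half of the
  -- quadratic penalty, and for pairing `K` with the bounded spectral matrix.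
  refine ⟨q * Real.log c₂ + ∑ i, ∑ j, (K j i ^ 2 / β + q * c₂ * |K j i|), fun x hx => ?_⟩
  have hmem := hx.lam_mem hβ hc
  have hpos : ∀ i, 0 < x.2.2 i := fun i => hc₁.trans_le (hmem.2 i).1
  have hlog : ∑ i, Real.log (x.2.2 i) ≤ q * Real.log c₂ := by
    simpa using Finset.sum_le_sum fun i (_ : i ∈ Finset.univ) =>
      Real.log_le_log (hpos i) (hmem.2 i).2
  have htr : (K * lap x.1).trace = ∑ i, ∑ j, lap x.1 i j * K j i := by
    rw [Matrix.trace_mul_comm]; simp [Matrix.trace, Matrix.mul_apply]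
  have hmain : β / 4 * frobSq (lap x.1 - spectralMatrix x.2.1 x.2.2)
      - ∑ i, ∑ j, (K j i ^ 2 / β + q * c₂ * |K j i|)
      ≤ ∑ i, ∑ j, lap x.1 i j * K j i
        + β / 2 * frobSq (lap x.1 - spectralMatrix x.2.1 x.2.2) := by
    simp only [frobSq, Finset.mul_sum, ← Finset.sum_add_distrib, ← Finset.sum_sub_distrib]
    refine Finset.sum_le_sum fun i _ => Finset.sum_le_sum fun j _ => ?_
    rw [Matrix.sub_apply]
    have hM := hx.abs_spectralMatrix_le hβ hc₁ hc i j
    set M := spectralMatrix x.2.1 x.2.2 i j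
    have h1 : -(M * K j i) ≤ q * c₂ * |K j i| :=
      (neg_le_abs _).trans (by rw [abs_mul]; gcongr)
    have h2 : 0 ≤ β / 4 * (lap x.1 i j - M) ^ 2 + (lap x.1 i j - M) * K j i + K j i ^ 2 / β := by
      have : β / 4 * (lap x.1 i j - M) ^ 2 + (lap x.1 i j - M) * K j i + K j i ^ 2 / β
          = (β * (lap x.1 i j - M) / 2 + K j i) ^ 2 / β := by field_simp; ring
      rw [this]; positivity
    linarith
  rw [objective, Matrix.det_diagonal, Real.log_prod fun i _ => (hpos i).ne', ← hK, htr]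
  linarith

/-- Feasibility bounds `U` and `λ`. The weights are, up to sign, off-diagonal entries of `𝓛w`, a sum
of a bounded spectral matrix and a residual controlled by coercivity. -/
theorem exists_norm_le_of_objective_le (S : Matrix (Fin p) (Fin p) ℝ) (α : ℝ) (hβ : 0 < β)
    (hc₁ : 0 < c₁) (hc : c₁ ≤ c₂) (C : ℝ) : ∃ D : ℝ, ∀ x : Point p q,
      IsSpectralPoint β c₁ c₂ x → objective S α β x ≤ C → x ∈ Metric.closedBall 0 D := by
  obtain ⟨R, hR⟩ := exists_le_objective (p := p) (q := q) S α hβ hc₁ hc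
  have hc₂ : 0 < c₂ := hc₁.trans_le hc
  refine ⟨1 + c₂ + (|4 / β * (C + R)| + 1 + q * c₂), fun x hx hxC => ?_⟩
  have hmem := hx.lam_mem hβ hc
  have habs := abs_nonneg (4 / β * (C + R))
  have hqc : 0 ≤ q * c₂ := by positivity
  rw [mem_closedBall_zero_iff, Prod.norm_def, Prod.norm_def]
  refine max_le ?_ (max_le ?_ ?_)
  · refine (pi_norm_le_iff_of_nonneg (by positivity)).2 fun e => ?_
    set X := lap x.1 - spectralMatrix x.2.1 x.2.2 with hX
    have hf : frobSq X ≤ 4 / β * (C + R) := by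
      have := (hR x hx).trans hxC
      rw [div_mul_eq_mul_div, le_div_iff₀ hβ]
      linarith
    have hXe : X e.1.1 e.1.2 ^ 2 ≤ frobSq X :=
      (Finset.single_le_sum (f := fun j => X e.1.1 j ^ 2) (fun _ _ => sq_nonneg _)
        (Finset.mem_univ e.1.2)).trans
      (Finset.single_le_sum (f := fun i => ∑ j, X i j ^ 2)
        (fun _ _ => Finset.sum_nonneg fun _ _ => sq_nonneg _) (Finset.mem_univ e.1.1))
    have hwe : x.1 e = -(X e.1.1 e.1.2 + spectralMatrix x.2.1 x.2.2 e.1.1 e.1.2) := by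
      rw [hX, Matrix.sub_apply, lap_apply_edge]; ring
    have hM := hx.abs_spectralMatrix_le hβ hc₁ hc e.1.1 e.1.2
    have hX1 : |X e.1.1 e.1.2| ≤ X e.1.1 e.1.2 ^ 2 + 1 := by
      rw [← sq_abs]; nlinarith [sq_nonneg (|X e.1.1 e.1.2| - 1), abs_nonneg (X e.1.1 e.1.2)]
    have h3 := abs_add_le (X e.1.1 e.1.2) (spectralMatrix x.2.1 x.2.2 e.1.1 e.1.2)
    have h4 := le_abs_self (4 / β * (C + R))
    rw [Real.norm_eq_abs, hwe, abs_neg]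
    linarith
  · refine (pi_norm_le_iff_of_nonneg (by positivity)).2 fun i =>
      (pi_norm_le_iff_of_nonneg (by positivity)).2 fun l => ?_
    rw [Real.norm_eq_abs]
    linarith [abs_apply_le_one_of_orth hx.orth i l]
  · refine (pi_norm_le_iff_of_nonneg (by positivity)).2 fun l => ?_
    have hl := hmem.2 l
    rw [Real.norm_eq_abs, abs_of_pos (hc₁.trans_le hl.1)]
    linarith

end Bounds

/-! ### Vanishing increments and limit points -/

section Convergence

/-- If a sequence eventually stays in a compact set and all its limit points lie in `A`, then its
distance to `A` tends to zero. -/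
theorem tendsto_infEDist_of_mapClusterPt {X ι : Type*} [PseudoEMetricSpace X] {l : Filter ι}
    {x : ι → X} {s A : Set X} (hs : IsCompact s) (hx : ∀ᶠ t in l, x t ∈ s)
    (hA : ∀ y, MapClusterPt y l x → y ∈ A) :
    Tendsto (fun t => Metric.infEDist (x t) A) l (𝓝 0) := by
  rw [ENNReal.tendsto_nhds_zero]
  intro ε hε
  by_contra hne
  have hfreq : ∃ᶠ t in l, x t ∈ s ∩ {z | ε ≤ Metric.infEDist z A} :=
    ((not_eventually.1 hne).and_eventually hx).mono fun t ht => ⟨ht.2, (not_le.1 ht.1).le⟩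
  have hcpt : IsCompact (s ∩ {z | ε ≤ Metric.infEDist z A}) :=
    hs.inter_right (isClosed_le continuous_const Metric.continuous_infEDist)
  obtain ⟨a, ha, hcl⟩ := hcpt.exists_mapClusterPt_of_frequently hfreq
  have h0 : ε ≤ Metric.infEDist a A := ha.2
  rw [Metric.infEDist_zero_of_mem (hA a hcl)] at h0
  exact hε.not_ge h0

variable {k q : ℕ} {S : Matrix (Fin (k + q)) (Fin (k + q)) ℝ} {α β c₁ c₂ : ℝ}
  {x : ℕ → Point (k + q) q}

theorem IsSGLSequence.antitone_objective (hk : 1 ≤ k) (hβ : 0 < β) (hc₁ : 0 < c₁) (hc : c₁ ≤ c₂)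
    (hx : IsSGLSequence S α β c₁ c₂ x) : Antitone fun t => objective S α β (x (t + 1)) :=
  antitone_nat_of_succ_le fun t => by
    have h := hx.objective_add_le hk hβ hc₁ hc (hx.isSpectralPoint hk hβ hc t)
    have : 0 ≤ β * (k + q : ℕ) * ∑ e, ((x (t + 1 + 1)).1 e - (x (t + 1)).1 e) ^ 2 := by
      positivity
    linarith

/-- The objective values decrease and are bounded below, so their consecutive differences, which
dominate `βp‖Δw‖²`, tend to zero. -/
theorem IsSGLSequence.tendsto_sub (hk : 1 ≤ k) (hβ : 0 < β) (hc₁ : 0 < c₁) (hc : c₁ ≤ c₂)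
    (hx : IsSGLSequence S α β c₁ c₂ x) :
    Tendsto (fun t => (x (t + 1)).1 - (x t).1) atTop (𝓝 0) := by
  -- The starting point may be infeasible, so descent is available only from time 1.
  rw [← tendsto_add_atTop_iff_nat 1]
  obtain ⟨R, hR⟩ := exists_le_objective (q := q) S α hβ hc₁ hc
  have hspec := hx.isSpectralPoint hk hβ hc
  have hbdd : BddBelow (Set.range fun t => objective S α β (x (t + 1))) := by
    refine ⟨-R, ?_⟩
    rintro _ ⟨t, rfl⟩
    have h0 : 0 ≤ frobSq (lap (x (t + 1)).1 - spectralMatrix (x (t + 1)).2.1 (x (t + 1)).2.2) :=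
      Finset.sum_nonneg fun _ _ => Finset.sum_nonneg fun _ _ => sq_nonneg _
    have := hR _ (hspec t)
    have : 0 ≤ β / 4 * frobSq
      (lap (x (t + 1)).1 - spectralMatrix (x (t + 1)).2.1 (x (t + 1)).2.2) := by positivity
    simp only
    linarith
  have hlim := tendsto_atTop_ciInf (hx.antitone_objective hk hβ hc₁ hc) hbdd
  have hdiff := hlim.sub ((tendsto_add_atTop_iff_nat 1).2 hlim)
  rw [sub_self] at hdiff
  have hp : (0 : ℝ) < β * (k + q : ℕ) := by
    have : (0 : ℝ) < (k + q : ℕ) := by exact_mod_cast (by omega : 0 < k + q)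
    positivity
  rw [tendsto_pi_nhds]
  intro e
  have hsq : Tendsto (fun t => β * (k + q : ℕ) * ((x (t + 1 + 1)).1 e - (x (t + 1)).1 e) ^ 2)
      atTop (𝓝 0) := by
    refine squeeze_zero (fun t => by positivity) (fun t => ?_) hdiff
    have h1 := hx.objective_add_le hk hβ hc₁ hc (hspec t)
    have h2 := mul_le_mul_of_nonneg_left (Finset.single_le_sum
      (f := fun e => ((x (t + 1 + 1)).1 e - (x (t + 1)).1 e) ^ 2) (fun _ _ => sq_nonneg _)
      (Finset.mem_univ e)) hp.le
    linarith
  have hsq' := hsq.const_mul (β * (k + q : ℕ))⁻¹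
  simp only [inv_mul_cancel_left₀ hp.ne', mul_zero] at hsq'
  have := hsq'.sqrt
  simp only [Real.sqrt_sq_eq_abs, Real.sqrt_zero] at this
  exact (tendsto_zero_iff_abs_tendsto_zero _).2 this

/-- Along an ultrafilter converging to `y`, the next weights tend to `updateW S α β y` by continuity
and to `y.1` because increments vanish. No such control of `U` or `λ` is needed, since `updateW`
reads only the current iterate. -/
theorem IsSGLSequence.isKKT_of_mapClusterPt (hk : 1 ≤ k) (hβ : 0 < β) (hc₁ : 0 < c₁)
    (hc : c₁ ≤ c₂) (hx : IsSGLSequence S α β c₁ c₂ x) {y : Point (k + q) q}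
    (hy : MapClusterPt y atTop x) : IsKKT S α β c₁ c₂ y := by
  obtain ⟨𝒰, h𝒰, hlim⟩ := mapClusterPt_iff_ultrafilter.1 hy
  have hspec : IsSpectralPoint β c₁ c₂ y := by
    refine (isClosed_setOf_isSpectralPoint β c₁ c₂).mem_of_tendsto hlim
      (h𝒰 (eventually_atTop.2 ⟨1, fun t ht => ?_⟩))
    obtain ⟨s, rfl⟩ := Nat.exists_eq_add_of_le' ht
    exact hx.isSpectralPoint hk hβ hc s
  refine hspec.isKKT (by omega) hβ hc₁ hc ?_
  have h1 : Tendsto (fun t => (x (t + 1)).1) 𝒰 (𝓝 (updateW S α β y)) := by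
    refine (((continuous_updateW S α β).tendsto y).comp hlim).congr fun t => ?_
    exact (hx t).1.symm
  have h2 : Tendsto (fun t => (x (t + 1)).1) 𝒰 (𝓝 y.1) := by
    have := ((hx.tendsto_sub hk hβ hc₁ hc).mono_left h𝒰).add
      ((continuous_fst.tendsto y).comp hlim)
    simpa using this
  exact tendsto_nhds_unique h1 h2

end Convergence

end SGL

end

/-- Nonemptiness of the KKT set is part of the first conclusion: `Metric.infEDist` to the empty set
is `⊤`, which cannot tend to `0`. -/
theorem mainTheorem1 (k q : ℕ) (hk : 1 ≤ k) (hq : 1 ≤ q)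
    (S : Matrix (Fin (k + q)) (Fin (k + q)) ℝ) (α β c₁ c₂ : ℝ)
    (hβ : 0 < β) (hc₁ : 0 < c₁) (hc : c₁ ≤ c₂)
    (x : ℕ → SGL.Point (k + q) q) (hx : SGL.IsSGLSequence S α β c₁ c₂ x) :
    Tendsto (fun t => Metric.infEDist (x t) (SGL.kktSet (k + q) q S α β c₁ c₂)) atTop (𝓝 0) ∧
      ∀ y : SGL.Point (k + q) q, MapClusterPt y atTop x →
        y ∈ SGL.kktSet (k + q) q S α β c₁ c₂ := by
  have hcl : ∀ y : SGL.Point (k + q) q, MapClusterPt y atTop x →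
      y ∈ SGL.kktSet (k + q) q S α β c₁ c₂ := fun y hy =>
    hx.isKKT_of_mapClusterPt hk hβ hc₁ hc hy
  refine ⟨?_, hcl⟩
  -- From time 1 on, all iterates lie in the sublevel set of the first iterate, hence in one compact
  -- ball.
  obtain ⟨D, hD⟩ := SGL.exists_norm_le_of_objective_le (q := q) S α hβ hc₁ hc
    (SGL.objective S α β (x (0 + 1)))
  refine SGL.tendsto_infEDist_of_mapClusterPt (isCompact_closedBall 0 D) ?_ hcl
  refine eventually_atTop.2 ⟨1, fun t ht => ?_⟩
  obtain ⟨s, rfl⟩ := Nat.exists_eq_add_of_le' ht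
  exact hD _ (hx.isSpectralPoint hk hβ hc s)
    (hx.antitone_objective hk hβ hc₁ hc (Nat.zero_le s))
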